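/- **Setting.** Let $D\subset\mathbb R^2$ be a bounded polygonal Lipschitz domain, $\mathcal T$ a conforming triangulation of $D$ into closed triangles $T$ (so $\bigcup_{T\in\mathcal T}T=\overline D$), $h_T$ the diameter of $T$, and for each edge $E$ let $n_E$ be a unit normal with arbitrary fixed sign. $\mathcal T$ is $\kappa$-shape regular if every $T$ contains a disc of some radius $r>0$ with $h_T\le\kappa r$. For an elementwise polynomial field $\xi$, $\llbracket\xi\rrbracket_{\partial T}=(\xi|_T-\xi|_{T'})\cdot n_E$ on an edge $E$ that $T$ shares with $T'$, and $\llbracket\xi\rrbracket_{\partial T}=0$ on edges in $\partial D$. Let $p\ge1$ and let $\mathcal X_p(\mathcal T)$ be the continuous functions on $\overline D$ that are polynomials of degree at most $p$ on every $T$. A number $c_{\mathrm{inv}}>0$ is called an *inverse constant of $\mathcal T$* if for all elementwise polynomial (possibly discontinuous) vector fields $\xi$ of degree at most $2p-1$ and all $T\in\mathcal T$ $$h_T^{1/2}\|\xi|_T\cdot n\|_{\partial T\cap D}\le c_{\mathrm{inv}}\|\xi\|_T,\qquad h_T\|\operatorname{div}\xi\|_T\le c_{\mathrm{inv}}\|\xi\|_T,\qquad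 \Bigl(\sum_{T\in\mathcal T}h_T\|\llbracket\xi\rrbracket_{\partial T}\|_{\partial T\cap D}^2\Bigr)^{1/2}\le c_{\mathrm{inv}}\|\xi\|_D ,$$ where $\|\cdot\|_S$ is the $L^2(S)$ norm and derivatives are elementwise. Let $\hat M\in\mathbb N$, $\gamma_1,\dots,\gamma_{\hat M}\in L^\infty(D)$, $\rho\ge0$, $\vartheta\in[0,1]$, $f\in L^2(D)$, and put $\sigma_m=\exp(\vartheta\rho\|\gamma_m\|_{L^\infty(D)})$. Let $\pi_0$ be the standard Gaussian measure on $\mathbb R^{\hat M}$ and $\zeta_{\vartheta\rho}(y)=\prod_m\sigma_m^{-1}\exp\bigl((\tfrac12-\tfrac1{2\sigma_m^2})y_m^2\bigr)$ the density of $\pi_{\vartheta\rho}=\bigotimes_m\mathcal N(0,\sigma_m^2)$ with respect to $\pi_0$. Let $P_\mu(y)=\prod_mP^m_{\mu_m}(y_m)$, $\mu\in\mathbb N_0^{\hat M}$, where $P^m_k$ is the orthonormal (scaled Hermite) polynomial of degree $k$ for $\mathcal N(0,\sigma_m^2)$, and $\tau_{\alpha\beta\mu}=\int P_\alpha P_\beta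 P_\mu\,\mathrm d\pi_{\vartheta\rho}$. For $d,\hat d\in\mathbb N^{\hat M}$ (all entries at least $1$) let $\Lambda_d=\{\mu\in\mathbb N_0^{\hat M}:\mu_m\le d_m-1\ \forall m\}$ and $\partial\Lambda_d=\Lambda_{d+\hat d-1}\setminus\Lambda_d$, where $1=(1,\dots,1)$. Let $\mathcal V_N(\Lambda_d;\mathcal T,p)$ be the set of all $\sum_{\mu\in\Lambda_d}w_\mu(x)P_\mu(y)$ with $w_\mu\in\mathcal X_p(\mathcal T)$, and fix a coefficient $a_N=\sum_{\beta\in\Lambda_{\hat d}}a_\beta P_\beta\in\mathcal V_N(\Lambda_{\hat d};\mathcal T,p)$. For $v_N=\sum_{\alpha\in\Lambda_d}v_\alpha P_\alpha\in\mathcal V_N(\Lambda_d;\mathcal T,p)$ and $\mu\in\mathbb N_0^{\hat M}$ put $r_\mu(v_N)=\sum_{\alpha\in\Lambda_d}\sum_{\beta\in\Lambda_{\hat d}}\tau_{\alpha\beta\mu}\,a_\beta\nabla v_\alpha$. With $\|\cdot\|_{\pi_0,S}$ the norm of $L^2(\mathbb R^{\hat M},\pi_0;L^2(S))$, taking values in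 $[0,\infty]$, define for $\Lambda,\Delta\subset\mathbb N_0^{\hat M}$ $$\eta_{\det}(v_N,\mathcal T,\Lambda)^2=\sum_{T\in\mathcal T}\Bigl(h_T^2\Bigl\|\sum_{\mu\in\Lambda}(f\delta_{\mu0}-\operatorname{div}r_\mu(v_N))P_\mu\zeta_{\vartheta\rho}\Bigr\|_{\pi_0,T}^2+h_T\Bigl\|\sum_{\mu\in\Lambda}\llbracket r_\mu(v_N)\rrbracket_{\partial T}P_\mu\zeta_{\vartheta\rho}\Bigr\|_{\pi_0,\partial T}^2\Bigr),$$ $$\eta_{\mathrm{sto}}(v_N,\Delta)=\Bigl\|\sum_{\mu\in\Delta}r_\mu(v_N)P_\mu\zeta_{\vartheta\rho}\Bigr\|_{\pi_0,D}.$$ **Theorem 4.8.** (i) For every $p\ge1$ and $\kappa>0$ there is a number $c_{\mathrm{inv}}>0$, depending only on $p$ and $\kappa$, that is an inverse constant of every $\kappa$-shape regular triangulation of every such domain. (ii) Let $c_{\mathrm{inv}}$ be an inverse constant of $\mathcal T$. Then for every set $\hat\Lambda\subset\mathbb N_0^{\hat M}$ with $\Lambda_d\subset\hat\Lambda$, with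 $\Delta=\hat\Lambda\cap\partial\Lambda_d$, and every $v_N\in\mathcal V_N(\Lambda_d;\mathcal T,p)$, $$\eta_{\det}(v_N,\mathcal T,\hat\Lambda\setminus\Lambda_d)\le\tilde c_{\det}\,\eta_{\mathrm{sto}}(v_N,\Delta),\qquad \tilde c_{\det}^2=2c_{\mathrm{inv}}^2 .$$ -/

import Mathlib

open MeasureTheory ProbabilityTheory
open scoped ENNReal

noncomputable section

namespace SGFEM

/-- The Euclidean plane. -/
abbrev Plane : Type := EuclideanSpace ℝ (Fin 2)

/-! ### Triangulations -/

/-- A conforming triangulation of `D`. A triangle is given by the finite set of its three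
(affinely independent) vertices; the closed triangle is the convex hull of that set. Two closed
triangles meet exactly in the convex hull of their common vertices (the empty set, a common vertex,
a common edge or the whole triangle), and the closed triangles cover the closure of `D` exactly.
The last field says that `D` is the interior of its closure, as any Lipschitz domain is. -/
structure Triangulation (D : Set Plane) where
  triangles : Finset (Finset Plane)
  card_eq : ∀ t ∈ triangles, t.card = 3
  indep : ∀ t ∈ triangles, AffineIndependent ℝ (fun v : t => (v : Plane))
  conforming : ∀ s ∈ triangles, ∀ t ∈ triangles,
    convexHull ℝ (s : Set Plane) ∩ convexHull ℝ (t : Set Plane) =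
      convexHull ℝ ((s : Set Plane) ∩ (t : Set Plane))
  cover : (⋃ t ∈ triangles, convexHull ℝ (t : Set Plane)) = closure D
  regular : interior (closure D) = D

/-- The closed triangle (or edge) with the given vertices. -/
def hull (t : Finset Plane) : Set Plane := convexHull ℝ (t : Set Plane)

/-- The diameter `h_T`. -/
def diam (t : Finset Plane) : ℝ := Metric.diam (hull t)

/-- The (two-point vertex sets of the) edges of a triangle. -/
def edges (t : Finset Plane) : Finset (Finset Plane) := t.powersetCard 2

/-- Shape regularity with parameter `κ`: every triangle `T` contains a disc of some radius `r > 0`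
with `h_T ≤ κ r`. -/
def Triangulation.ShapeRegular {D : Set Plane} (K : Triangulation D) (κ : ℝ) : Prop :=
  ∀ t ∈ K.triangles, ∃ x : Plane, ∃ r : ℝ, 0 < r ∧ Metric.closedBall x r ⊆ hull t ∧ diam t ≤ κ * r

open Classical in
/-- The triangles other than `t` that have the edge `e`: one triangle if `e` is an edge of `t`
in the interior of the domain, none if `e` lies on the boundary. -/
def Triangulation.neighbours {D : Set Plane} (K : Triangulation D) (t e : Finset Plane) :
    Finset (Finset Plane) :=
  K.triangles.filter (fun t' => t' ≠ t ∧ e ⊆ t')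

open Classical in
/-- The edges that make up `∂T ∩ D`. -/
def Triangulation.interiorEdges {D : Set Plane} (K : Triangulation D) (t : Finset Plane) :
    Finset (Finset Plane) :=
  (edges t).filter (fun e => (K.neighbours t e).Nonempty)

/-- `n` assigns to each edge a unit vector orthogonal to it (an arbitrary choice of sign). -/
def Triangulation.IsUnitNormal {D : Set Plane} (K : Triangulation D) (n : Finset Plane → Plane) :
    Prop :=
  ∀ t ∈ K.triangles, ∀ e ∈ edges t, ‖n e‖ = 1 ∧ ∀ a ∈ e, ∀ b ∈ e, inner ℝ (n e) (a - b) = 0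

/-- The normal jump `⟦ξ⟧ = (ξ|_T - ξ|_{T'}) · n_E` over the edge `e` of `t`, where `T'` is the other
triangle at `e`. Here `ξ s` is the restriction of the field to the closed triangle `s`. The value is
zero on edges on the boundary of the domain. -/
def Triangulation.jump {D : Set Plane} (K : Triangulation D) (n : Finset Plane → Plane)
    (ξ : Finset Plane → Plane → Plane) (t e : Finset Plane) (x : Plane) : ℝ :=
  ∑ t' ∈ K.neighbours t e, inner ℝ (ξ t x - ξ t' x) (n e)

/-- The area measure on a closed triangle. -/
def area (t : Finset Plane) : Measure Plane := volume.restrict (hull t)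

/-- The arc length measure on an edge. -/
def arc (e : Finset Plane) : Measure Plane := (Measure.hausdorffMeasure 1).restrict (hull e)

/-- The squared `L²(ν)` norm, with value in `[0, ∞]`. -/
def sqNorm {F : Type*} [NormedAddCommGroup F] (ν : Measure Plane) (g : Plane → F) : ℝ≥0∞ :=
  ∫⁻ x, ‖g x‖ₑ ^ 2 ∂ν

/-- The divergence of a field on `S`, by derivatives within `S`. On a closed triangle this
is the elementwise divergence up to the boundary. -/
def divWithin (S : Set Plane) (ξ : Plane → Plane) (x : Plane) : ℝ :=
  ∑ i : Fin 2, (fderivWithin ℝ ξ S x (EuclideanSpace.single i 1)) i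

/-! ### Finite elements and inverse estimates -/

/-- `g` agrees on `S` with a real polynomial in two variables of degree at most `k`. -/
def IsPolyOn (k : ℕ) (S : Set Plane) (g : Plane → ℝ) : Prop :=
  ∃ q : MvPolynomial (Fin 2) ℝ, q.totalDegree ≤ k ∧
    ∀ x ∈ S, g x = MvPolynomial.eval (fun i => x i) q

/-- The conforming Lagrange space `X_p(𝒯) = P_p(𝒯) ∩ C(closure D)`. -/
def Triangulation.IsLagrange {D : Set Plane} (K : Triangulation D) (p : ℕ) (v : Plane → ℝ) :
    Prop :=
  ContinuousOn v (closure D) ∧ ∀ t ∈ K.triangles, IsPolyOn p (hull t) v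

/-- Elementwise polynomial (in general discontinuous) vector fields of degree at most `k`. -/
def Triangulation.IsPolyField {D : Set Plane} (K : Triangulation D) (k : ℕ)
    (ξ : Finset Plane → Plane → Plane) : Prop :=
  ∀ t ∈ K.triangles, ∀ i : Fin 2, IsPolyOn k (hull t) (fun x => ξ t x i)

/-- `c` is a constant in the inverse estimates for elementwise polynomial fields of degree at
most `k` (all norms are squared):
`h_T^{1/2} ‖ξ · n_T‖_{∂T ∩ D} ≤ c ‖ξ‖_T` and `h_T ‖div ξ‖_T ≤ c ‖ξ‖_T` on each triangle `T`, and
`(∑_T h_T ‖⟦ξ⟧‖²_{∂T ∩ D})^{1/2} ≤ c ‖ξ‖_D`, which is the first estimate for jumps. -/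
structure Triangulation.InverseEstimates {D : Set Plane} (K : Triangulation D)
    (n : Finset Plane → Plane) (k : ℕ) (c : ℝ) : Prop where
  trace : ∀ ξ, K.IsPolyField k ξ → ∀ t ∈ K.triangles,
    ENNReal.ofReal (diam t) *
        ∑ e ∈ K.interiorEdges t, sqNorm (arc e) (fun x => inner ℝ (ξ t x) (n e))
      ≤ ENNReal.ofReal c ^ 2 * sqNorm (area t) (ξ t)
  div : ∀ ξ, K.IsPolyField k ξ → ∀ t ∈ K.triangles,
    ENNReal.ofReal (diam t) ^ 2 * sqNorm (area t) (divWithin (hull t) (ξ t))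
      ≤ ENNReal.ofReal c ^ 2 * sqNorm (area t) (ξ t)
  jump : ∀ ξ, K.IsPolyField k ξ →
    ∑ t ∈ K.triangles, ENNReal.ofReal (diam t) *
        ∑ e ∈ edges t, sqNorm (arc e) (K.jump n ξ t e)
      ≤ ENNReal.ofReal c ^ 2 * ∑ t ∈ K.triangles, sqNorm (area t) (ξ t)

/-! ### The parameter space -/

/-- `σ_m(ρ) = exp(ρ ‖γ_m‖_{L^∞(D)})`. -/
def sigma {M : ℕ} (D : Set Plane) (γ : Fin M → Plane → ℝ) (ρ : ℝ) (m : Fin M) : ℝ :=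
  Real.exp (ρ * (eLpNorm (γ m) ∞ (volume.restrict D)).toReal)

/-- The product over `m` of the Radon-Nikodym derivatives of `N(0, s_m²)` with respect to
`N(0, 1)`; with `s = sigma D γ ρ` this is `ζ_ρ`. -/
def zeta {M : ℕ} (s : Fin M → ℝ) (y : Fin M → ℝ) : ℝ :=
  ∏ m, 1 / s m * Real.exp ((1 / 2 - 1 / (2 * s m ^ 2)) * y m ^ 2)

/-- The standard Gaussian product measure `π_0`. -/
def piZero (M : ℕ) : Measure (Fin M → ℝ) := Measure.pi (fun _ => gaussianReal 0 1)

/-- The orthonormal polynomial of degree `k` for the measure `N(0, s²)`: a scaled (probabilists')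
Hermite polynomial. -/
def scaledHermite (s : ℝ) (k : ℕ) (z : ℝ) : ℝ :=
  Polynomial.aeval (z / s) (Polynomial.hermite k) / Real.sqrt (k.factorial : ℝ)

/-- The tensorized basis `P_μ(y) = ∏_m P^m_{μ_m}(y_m)`. -/
def basisPoly {M : ℕ} (s : Fin M → ℝ) (μ : Fin M → ℕ) (y : Fin M → ℝ) : ℝ :=
  ∏ m, scaledHermite (s m) (μ m) (y m)

/-- The triple product `τ_{αβμ} = ∏_m ∫ P^m_{α_m} P^m_{β_m} P^m_{μ_m} dN(0, s_m²)`. -/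
def tripleProd {M : ℕ} (s : Fin M → ℝ) (α β μ : Fin M → ℕ) : ℝ :=
  ∏ m, ∫ z, scaledHermite (s m) (α m) z * scaledHermite (s m) (β m) z *
    scaledHermite (s m) (μ m) z ∂(gaussianReal 0 (Real.toNNReal (s m ^ 2)))

/-- The full tensor index set `Λ_d = {μ : 0 ≤ μ_m ≤ d_m - 1 for all m}`. -/
def indexBox {M : ℕ} (d : Fin M → ℕ) : Finset (Fin M → ℕ) :=
  Fintype.piFinset (fun m => Finset.range (d m))

/-- The boundary `∂Λ_d = Λ_{d + d̂ - 1} \ Λ_d` of `Λ_d` with respect to `Λ_{d̂}`. -/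
def indexBoundary {M : ℕ} (d dhat : Fin M → ℕ) : Set (Fin M → ℕ) :=
  (indexBox (fun m => d m + dhat m - 1) : Set (Fin M → ℕ)) \ (indexBox d : Set (Fin M → ℕ))

/-- An element `∑_{μ ∈ Λ_d} w_μ(x) P_μ(y)` of the discrete space `V_N(Λ_d; 𝒯, p)`, given by its
coefficients `w_μ ∈ X_p(𝒯)`. -/
structure DiscreteFun {D : Set Plane} (K : Triangulation D) (p : ℕ) {M : ℕ} (d : Fin M → ℕ) where
  coeff : (Fin M → ℕ) → Plane → ℝ
  coeff_mem : ∀ μ ∈ indexBox d, K.IsLagrange p (coeff μ)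

/-- The squared norm of `L²(ℝ^M, π_0; L²(ν))`, with value in `[0, ∞]`. -/
def mixedSqNorm {M : ℕ} {F : Type*} [NormedAddCommGroup F] (ν : Measure Plane)
    (g : Plane → (Fin M → ℝ) → F) : ℝ≥0∞ :=
  ∫⁻ y, sqNorm ν (fun x => g x y) ∂(piZero M)

/-! ### The estimator contributions -/

section Estimator

variable {D : Set Plane} {K : Triangulation D} {p M : ℕ} {d dhat : Fin M → ℕ}

/-- The coefficient `r_μ(w) = ∑_{α ∈ Λ_d} ∑_{β ∈ Λ_d̂} τ_{αβμ} a_β ∇w_α` of `a ∇w` with respect to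
`P_μ`, with gradients taken within `S`. For `S` a closed triangle `T` this is `r_μ(w)|_T`, including
its one-sided boundary values; for `S = D` it is the field `r_μ(w)` on `D` (almost everywhere). -/
def resCoeff (s : Fin M → ℝ) (a : DiscreteFun K p dhat) (w : DiscreteFun K p d)
    (S : Set Plane) (μ : Fin M → ℕ) (x : Plane) : Plane :=
  ∑ α ∈ indexBox d, ∑ β ∈ indexBox dhat,
    (tripleProd s α β μ * a.coeff β x) • gradientWithin (w.coeff α) S x

/-- The volume contribution
`η_{det,T}(w, Λ) = h_T ‖∑_{μ ∈ Λ} (f δ_{μ0} - div r_μ(w)) P_μ ζ‖_{π_0, T}`, squared. -/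
def etaVolSq (s : Fin M → ℝ) (a : DiscreteFun K p dhat) (f : Plane → ℝ) (w : DiscreteFun K p d)
    (t : Finset Plane) (Λ : Set (Fin M → ℕ)) : ℝ≥0∞ :=
  ENNReal.ofReal (diam t) ^ 2 *
    mixedSqNorm (area t) (fun x y => ∑' μ : Λ,
      ((if (μ : Fin M → ℕ) = 0 then f x else 0)
        - divWithin (hull t) (resCoeff s a w (hull t) μ) x) * basisPoly s μ y * zeta s y)

/-- The jump contribution
`η_{det,∂T}(w, Λ) = h_T^{1/2} ‖∑_{μ ∈ Λ} ⟦r_μ(w)⟧ P_μ ζ‖_{π_0, ∂T}`, squared. -/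
def etaJumpSq (n : Finset Plane → Plane) (s : Fin M → ℝ) (a : DiscreteFun K p dhat)
    (w : DiscreteFun K p d) (t : Finset Plane) (Λ : Set (Fin M → ℕ)) : ℝ≥0∞ :=
  ENNReal.ofReal (diam t) *
    ∑ e ∈ edges t, mixedSqNorm (arc e) (fun x y => ∑' μ : Λ,
      K.jump n (fun t' => resCoeff s a w (hull t') μ) t e x * basisPoly s μ y * zeta s y)

/-- The deterministic estimator contribution `η_det(w, 𝒯, Λ)`. -/
def etaDet (n : Finset Plane → Plane) (s : Fin M → ℝ) (a : DiscreteFun K p dhat)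
    (f : Plane → ℝ) (w : DiscreteFun K p d) (Λ : Set (Fin M → ℕ)) : ℝ≥0∞ :=
  (∑ t ∈ K.triangles, (etaVolSq s a f w t Λ + etaJumpSq n s a w t Λ)) ^ (1 / 2 : ℝ)

/-- The stochastic estimator contribution
`η_sto(w, Δ) = ‖∑_{μ ∈ Δ} r_μ(w) P_μ ζ‖_{π_0, D}`. -/
def etaSto (s : Fin M → ℝ) (a : DiscreteFun K p dhat) (w : DiscreteFun K p d)
    (Δ : Set (Fin M → ℕ)) : ℝ≥0∞ :=
  (mixedSqNorm (volume.restrict D) (fun x y => ∑' μ : Δ,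
    (basisPoly s μ y * zeta s y) • resCoeff s a w D μ x)) ^ (1 / 2 : ℝ)

end Estimator

end SGFEM

end

noncomputable section

namespace SGFEM

/-! ### Polynomial functions on the plane -/

/-! The inverse estimates come from norm equivalence on a finite-dimensional space, applied on discs
so that no reference triangle is needed. Polynomials of degree at most `k` embed into `L²` of the
unit disc, so their values and derivatives on the disc of radius `κ` are bounded by that norm. If
`T` contains a disc of radius `r` with `h_T ≤ κ r`, then `T` lies in the concentric disc of radius
`κ r`. Scaling therefore bounds `h_T² |ξ|²` and `h_T⁴ |div ξ|²` pointwise on `T` by a multiple of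
`‖ξ‖_T²` (`exists_field_bound`). Integration over edges of length at most `h_T`, and over `T` with
area at most that of a disc of radius `h_T`, gives the trace and divergence estimates. For the
jumps, triangles with a common edge have comparable diameters, and comparing areas bounds how many
of them there are (`Triangulation.ShapeRegular.card_neighbours_le`).

In the estimator comparison two observations reduce the index set to `Δ`: the load `f` enters only
at `μ = 0`, which lies in `Λ_d`, and Hermite orthogonality makes `r_μ` vanish outside `Λ_{d+d̂-1}`
(`tripleProd_eq_zero`). For each fixed `y` the remaining finite sum `∑ P_μ(y) ζ(y) r_μ` is an
elementwise polynomial field of degree at most `p + (p - 1)`. The divergence and jump estimates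
apply to this field and contribute `c²` each; integrating over `y` gives `2c²` (`etaDet_le`). Since
the argument is pointwise in `y`, no orthogonality in the weighted norm is needed, and
superadditivity of the lower integral replaces measurability. -/

/-- The function on the plane defined by a polynomial in two variables. -/
def polyFun (q : MvPolynomial (Fin 2) ℝ) (x : Plane) : ℝ := MvPolynomial.eval (fun i => x i) q

lemma contDiff_polyFun (q : MvPolynomial (Fin 2) ℝ) : ContDiff ℝ 1 (polyFun q) := by
  have h := AnalyticOnNhd.eval_continuousLinearMap' (𝕜 := ℝ) (E := Plane)
    (fun i : Fin 2 => (EuclideanSpace.proj i : Plane →L[ℝ] ℝ)) q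
  exact h.contDiff

lemma continuous_polyFun (q : MvPolynomial (Fin 2) ℝ) : Continuous (polyFun q) :=
  (contDiff_polyFun q).continuous

lemma differentiable_polyFun (q : MvPolynomial (Fin 2) ℝ) : Differentiable ℝ (polyFun q) :=
  (contDiff_polyFun q).differentiable one_ne_zero

lemma polyFun_add (q₁ q₂ : MvPolynomial (Fin 2) ℝ) :
    polyFun (q₁ + q₂) = polyFun q₁ + polyFun q₂ := by
  ext x; simp [polyFun]

lemma polyFun_smul (c : ℝ) (q : MvPolynomial (Fin 2) ℝ) :
    polyFun (c • q) = c • polyFun q := by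
  ext x; simp [polyFun]

lemma fderiv_polyFun_add (q₁ q₂ : MvPolynomial (Fin 2) ℝ) (x : Plane) :
    fderiv ℝ (polyFun (q₁ + q₂)) x = fderiv ℝ (polyFun q₁) x + fderiv ℝ (polyFun q₂) x := by
  rw [polyFun_add]
  exact fderiv_add (differentiable_polyFun q₁ x) (differentiable_polyFun q₂ x)

lemma fderiv_polyFun_smul (c : ℝ) (q : MvPolynomial (Fin 2) ℝ) (x : Plane) :
    fderiv ℝ (polyFun (c • q)) x = c • fderiv ℝ (polyFun q) x := by
  rw [polyFun_smul]
  exact fderiv_const_smul (differentiable_polyFun q x) c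

lemma fderiv_polyFun_single (q : MvPolynomial (Fin 2) ℝ) (x : Plane) (i : Fin 2) :
    fderiv ℝ (polyFun q) x (EuclideanSpace.single i 1) = polyFun (MvPolynomial.pderiv i q) x := by
  induction q using MvPolynomial.induction_on with
  | C a =>
    have : polyFun (MvPolynomial.C a) = fun _ => a := by ext x; simp [polyFun]
    rw [this]
    simp [polyFun]
  | add q₁ q₂ h₁ h₂ =>
    rw [fderiv_polyFun_add, map_add, polyFun_add]
    simp [h₁, h₂]
  | mul_X q j h =>
    have hX : HasFDerivAt (fun x : Plane => x j) (EuclideanSpace.proj j : Plane →L[ℝ] ℝ) x :=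
      (EuclideanSpace.proj j : Plane →L[ℝ] ℝ).hasFDerivAt
    have hm : polyFun (q * MvPolynomial.X j) = fun x => polyFun q x * x j := by
      ext x; simp [polyFun]
    have hd := (differentiable_polyFun q x).hasFDerivAt.fun_mul hX
    rw [hm, hd.fderiv]
    by_cases hij : i = j
    · subst hij
      simp [h, Derivation.leibniz, polyFun]
    · simp [h, Derivation.leibniz, polyFun, MvPolynomial.pderiv_X, Ne.symm hij]

lemma totalDegree_pderiv_le {σ : Type*} (q : MvPolynomial σ ℝ) (i : σ) :
    (MvPolynomial.pderiv i q).totalDegree ≤ q.totalDegree - 1 := by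
  classical
  conv_lhs => rw [q.as_sum, map_sum]
  refine MvPolynomial.totalDegree_finsetSum_le fun s hs => ?_
  rw [MvPolynomial.pderiv_monomial]
  by_cases h0 : s i = 0
  · simp [h0]
  refine (MvPolynomial.totalDegree_monomial_le _ _).trans ?_
  have h1 : (s - Finsupp.single i 1).degree + 1 = s.degree := by
    have h : s - Finsupp.single i 1 + Finsupp.single i 1 = s :=
      tsub_add_cancel_of_le (by simpa [Nat.one_le_iff_ne_zero] using h0)
    conv_rhs => rw [← h]
    simp
  have h2 := MvPolynomial.le_totalDegree hs
  change s.degree ≤ _ at h2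
  change (s - Finsupp.single i 1).degree ≤ _
  omega

/-- Substituting polynomials of degree at most one does not raise the degree. This moves estimates
between an arbitrary disc and the unit disc. -/
lemma exists_polyFun_affine (q : MvPolynomial (Fin 2) ℝ) (x₀ : Plane) (r : ℝ) :
    ∃ q' : MvPolynomial (Fin 2) ℝ, q'.totalDegree ≤ q.totalDegree ∧
      ∀ z, polyFun q' z = polyFun q (x₀ + r • z) := by
  set g : Fin 2 → MvPolynomial (Fin 2) ℝ :=
    fun i => MvPolynomial.C (x₀ i) + MvPolynomial.C r * MvPolynomial.X i
  have hg : ∀ i, (g i).totalDegree ≤ 1 := fun i => by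
    refine (MvPolynomial.totalDegree_add _ _).trans (max_le (by simp) ?_)
    refine (MvPolynomial.totalDegree_mul _ _).trans (by simp)
  refine ⟨MvPolynomial.bind₁ g q, ?_, fun z => ?_⟩
  · conv_lhs => rw [q.as_sum, map_sum]
    refine MvPolynomial.totalDegree_finsetSum_le fun s hs => ?_
    rw [MvPolynomial.bind₁_monomial]
    refine (MvPolynomial.totalDegree_mul _ _).trans ?_
    rw [MvPolynomial.totalDegree_C, zero_add]
    refine (MvPolynomial.totalDegree_finsetProd _ _).trans ?_
    refine le_trans (Finset.sum_le_sum fun i _ => ?_) (MvPolynomial.le_totalDegree hs)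
    exact (MvPolynomial.totalDegree_pow _ _).trans ((Nat.mul_le_mul_left _ (hg i)).trans (by simp))
  · simp only [polyFun]
    induction q using MvPolynomial.induction_on with
    | C a => simp
    | add q₁ q₂ h₁ h₂ => simp [h₁, h₂]
    | mul_X q j h => simp [h, g]

/-! ### Equivalence of norms for polynomials -/

/-- Pulling the norm back along `L` makes `V` a finite-dimensional normed space, on which every
linear map is bounded. -/
lemma exists_norm_le_of_injective {V X Y : Type*} [AddCommGroup V] [Module ℝ V]
    [FiniteDimensional ℝ V] [NormedAddCommGroup X] [NormedSpace ℝ X] [NormedAddCommGroup Y]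
    [NormedSpace ℝ Y] (L : V →ₗ[ℝ] X) (hL : Function.Injective L) (E : V →ₗ[ℝ] Y) :
    ∃ C : ℝ, 0 < C ∧ ∀ v, ‖E v‖ ≤ C * ‖L v‖ := by
  let : NormedAddCommGroup V := NormedAddCommGroup.induced V X L hL
  let : NormedSpace ℝ V := NormedSpace.induced ℝ V X L
  refine ⟨‖LinearMap.toContinuousLinearMap E‖ + 1, by positivity, fun v => ?_⟩
  refine ((LinearMap.toContinuousLinearMap E).le_opNorm v).trans ?_
  have : ‖v‖ = ‖L v‖ := rfl
  rw [this]
  gcongr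
  linarith

/-- The closed unit disc. -/
abbrev unitDisc : Set Plane := Metric.closedBall 0 1

lemma memLp_polyFun (q : MvPolynomial (Fin 2) ℝ) :
    MemLp (polyFun q) 2 (volume.restrict unitDisc) := by
  have hc : IsCompact unitDisc := isCompact_closedBall _ _
  have : IsFiniteMeasure (volume.restrict unitDisc) := ⟨by
    rw [Measure.restrict_apply_univ]; exact hc.measure_lt_top⟩
  obtain ⟨C, hC⟩ := hc.exists_bound_of_continuousOn (continuous_polyFun q).continuousOn
  refine MemLp.of_bound (continuous_polyFun q).aestronglyMeasurable C ?_
  filter_upwards [ae_restrict_mem Metric.isClosed_closedBall.measurableSet] with x hx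
  exact hC x hx

/-- Polynomials of bounded degree as elements of `L²` of the unit disc. -/
def polyToLp (k : ℕ) :
    MvPolynomial.restrictTotalDegree (Fin 2) ℝ k →ₗ[ℝ] Lp ℝ 2 (volume.restrict unitDisc) where
  toFun q := (memLp_polyFun q.1).toLp
  map_add' q₁ q₂ := by
    rw [← MemLp.toLp_add]
    congr 1
    exact polyFun_add _ _
  map_smul' c q := by
    rw [RingHom.id_apply, ← MemLp.toLp_const_smul]
    congr 1
    exact polyFun_smul _ _

/-- The disc contains an open square, and a polynomial vanishing on a product of infinite sets is
zero. -/
lemma eq_zero_of_polyFun_eq_zero (q : MvPolynomial (Fin 2) ℝ)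
    (h : ∀ x ∈ Metric.ball (0 : Plane) 1, polyFun q x = 0) : q = 0 := by
  refine MvPolynomial.funext_set (fun _ => Set.Ioo (-(1 / 2) : ℝ) (1 / 2))
    (fun _ => Set.Ioo_infinite (by norm_num)) fun x hx => ?_
  rw [map_zero]
  refine h (WithLp.toLp 2 x) ?_
  have h0 := hx 0 trivial
  have h1 := hx 1 trivial
  simp only [Set.mem_Ioo] at h0 h1
  rw [Metric.mem_ball, dist_zero_right, EuclideanSpace.norm_eq, Real.sqrt_lt' one_pos,
    Fin.sum_univ_two]
  simp only [Real.norm_eq_abs, sq_abs]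
  nlinarith

lemma polyToLp_injective (k : ℕ) : Function.Injective (polyToLp k) := by
  rw [← LinearMap.ker_eq_bot, LinearMap.ker_eq_bot']
  intro q hq
  have h1 : polyFun q.1 =ᵐ[volume.restrict unitDisc] 0 := by
    have h := (memLp_polyFun q.1).coeFn_toLp
    rw [show (memLp_polyFun q.1).toLp = 0 from hq] at h
    exact h.symm.trans (Lp.coeFn_zero _ _ _)
  have h2 : polyFun q.1 =ᵐ[volume.restrict (Metric.ball (0 : Plane) 1)] 0 :=
    ae_restrict_of_ae_restrict_of_subset Metric.ball_subset_closedBall h1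
  have h3 : Set.EqOn (polyFun q.1) 0 (Metric.ball (0 : Plane) 1) :=
    Measure.eqOn_open_of_ae_eq h2 Metric.isOpen_ball (continuous_polyFun _).continuousOn
      continuousOn_const
  exact Subtype.ext (eq_zero_of_polyFun_eq_zero _ h3)

lemma norm_polyToLp_sq (k : ℕ) (q : MvPolynomial.restrictTotalDegree (Fin 2) ℝ k) :
    ENNReal.ofReal ‖polyToLp k q‖ ^ 2 = ∫⁻ z in unitDisc, ‖polyFun q.1 z‖ₑ ^ 2 := by
  change ENNReal.ofReal ‖(memLp_polyFun q.1).toLp‖ ^ 2 = _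
  rw [Lp.norm_toLp, ENNReal.ofReal_toReal (memLp_polyFun q.1).eLpNorm_ne_top]
  have := eLpNorm_nnreal_pow_eq_lintegral (f := polyFun q.1) (μ := volume.restrict unitDisc)
    (p := 2) (by norm_num)
  simpa using this

/-- On a disc of radius `κ`, a polynomial of degree at most `k` and its derivative are bounded by
the `L²` norm on the unit disc. -/
lemma exists_polyFun_bound_unitDisc (k : ℕ) (κ : ℝ) :
    ∃ C : ℝ, 0 < C ∧ ∀ q : MvPolynomial (Fin 2) ℝ, q.totalDegree ≤ k →
      ∀ z ∈ Metric.closedBall (0 : Plane) κ,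
        ‖polyFun q z‖ₑ ^ 2 ≤ ENNReal.ofReal C * ∫⁻ z in unitDisc, ‖polyFun q z‖ₑ ^ 2 ∧
        ‖fderiv ℝ (polyFun q) z‖ₑ ^ 2 ≤
          ENNReal.ofReal C * ∫⁻ z in unitDisc, ‖polyFun q z‖ₑ ^ 2 := by
  have : CompactSpace (Metric.closedBall (0 : Plane) κ) :=
    isCompact_iff_compactSpace.mp (isCompact_closedBall _ _)
  -- `E₀` and `E₁` restrict the polynomial and its derivative to the larger disc; the target norm is
  -- the supremum norm, so norm comparison yields pointwise bounds.
  let E₀ : MvPolynomial.restrictTotalDegree (Fin 2) ℝ k →ₗ[ℝ] C(Metric.closedBall (0 : Plane) κ, ℝ) :=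
    { toFun := fun q => ⟨fun z => polyFun q.1 z, (continuous_polyFun q.1).comp continuous_subtype_val⟩
      map_add' := fun q₁ q₂ => by ext z; simp [polyFun_add]
      map_smul' := fun c q => by ext z; simp [polyFun_smul] }
  let E₁ : MvPolynomial.restrictTotalDegree (Fin 2) ℝ k →ₗ[ℝ]
      C(Metric.closedBall (0 : Plane) κ, Plane →L[ℝ] ℝ) :=
    { toFun := fun q => ⟨fun z => fderiv ℝ (polyFun q.1) z,
        ((contDiff_polyFun q.1).continuous_fderiv one_ne_zero).comp continuous_subtype_val⟩
      map_add' := fun q₁ q₂ => ContinuousMap.ext fun z => fderiv_polyFun_add _ _ _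
      map_smul' := fun c q => ContinuousMap.ext fun z => fderiv_polyFun_smul _ _ _ }
  obtain ⟨C₀, hC₀, h₀⟩ := exists_norm_le_of_injective (polyToLp k) (polyToLp_injective k) E₀
  obtain ⟨C₁, hC₁, h₁⟩ := exists_norm_le_of_injective (polyToLp k) (polyToLp_injective k)
    (Y := C(Metric.closedBall (0 : Plane) κ, Plane →L[ℝ] ℝ)) E₁
  have key : ∀ (a c : ℝ) (q : MvPolynomial.restrictTotalDegree (Fin 2) ℝ k), 0 ≤ a → c ≤ C₀ + C₁ →
      a ≤ c * ‖polyToLp k q‖ → ENNReal.ofReal a ^ 2 ≤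
        ENNReal.ofReal ((C₀ + C₁) ^ 2) * ∫⁻ z in unitDisc, ‖polyFun q.1 z‖ₑ ^ 2 := by
    intro a c q ha hc hac
    rw [← norm_polyToLp_sq, ENNReal.ofReal_pow (by positivity), ← mul_pow,
      ← ENNReal.ofReal_mul (by positivity)]
    gcongr
    exact hac.trans (by gcongr)
  refine ⟨(C₀ + C₁) ^ 2, by positivity, fun q hq z hz => ?_⟩
  let q' : MvPolynomial.restrictTotalDegree (Fin 2) ℝ k :=
    ⟨q, (MvPolynomial.mem_restrictTotalDegree _ _ _).2 hq⟩
  constructor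
  · rw [← ofReal_norm]
    exact key _ C₀ q' (norm_nonneg _) (by linarith)
      (((E₀ q').norm_coe_le_norm ⟨z, hz⟩).trans (h₀ q'))
  · rw [← ofReal_norm]
    exact key _ C₁ q' (norm_nonneg _) (by linarith)
      (((E₁ q').norm_coe_le_norm ⟨z, hz⟩).trans (h₁ q'))

/-- Change of variables with Jacobian `r²` in the plane. The map is a homeomorphism, so `g` may be
arbitrary. -/
lemma lintegral_unitDisc_comp_affine (g : Plane → ℝ≥0∞) (x₀ : Plane) {r : ℝ} (hr : 0 < r) :
    ENNReal.ofReal (r ^ 2) * ∫⁻ z in unitDisc, g (x₀ + r • z) =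
      ∫⁻ x in Metric.closedBall x₀ r, g x := by
  let e : Plane ≃ₜ Plane := (Homeomorph.smulOfNeZero r hr.ne').trans (Homeomorph.addLeft x₀)
  have he : ∀ z, e z = x₀ + r • z := fun z => rfl
  have hmap : Measure.map e (volume : Measure Plane) =
      ENNReal.ofReal ((r ^ 2)⁻¹) • (volume : Measure Plane) := by
    have h1 := Measure.map_addHaar_smul (volume : Measure Plane) hr.ne'
    have h2 : (e : Plane → Plane) = (fun x => x₀ + x) ∘ (fun z => r • z) := rfl
    rw [h2, ← Measure.map_map (by fun_prop) (by fun_prop)]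
    change Measure.map _ (Measure.map (r • ·) _) = _
    rw [h1, Measure.map_smul, map_add_left_eq_self]
    simp [abs_of_pos hr]
  have hpre : e ⁻¹' Metric.closedBall x₀ r = unitDisc := by
    ext z
    simp [he, Metric.mem_closedBall, norm_smul, abs_of_pos hr, hr]
  have h3 : ∫⁻ x in Metric.closedBall x₀ r, g x ∂(Measure.map e volume) =
      ∫⁻ z in unitDisc, g (x₀ + r • z) := by
    rw [← hpre]
    have hm : MeasurePreserving e.toMeasurableEquiv (volume : Measure Plane) (Measure.map e volume) :=
      ⟨e.toMeasurableEquiv.measurable, rfl⟩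
    exact (hm.setLIntegral_comp_preimage_emb e.toMeasurableEquiv.measurableEmbedding g _).symm
  rw [← h3, hmap, Measure.restrict_smul, lintegral_smul_measure, smul_eq_mul, ← mul_assoc,
    ← ENNReal.ofReal_mul (by positivity), mul_inv_cancel₀ (by positivity), ENNReal.ofReal_one,
    one_mul]

/-- Scaled pointwise bounds of a polynomial and its derivative by the `L²` norm on a disc. -/
lemma exists_polyFun_bound (k : ℕ) (κ : ℝ) :
    ∃ C : ℝ, 0 < C ∧ ∀ q : MvPolynomial (Fin 2) ℝ, q.totalDegree ≤ k →
      ∀ (x₀ : Plane) (r : ℝ), 0 < r → ∀ x ∈ Metric.closedBall x₀ (κ * r),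
        ENNReal.ofReal (r ^ 2) * ‖polyFun q x‖ₑ ^ 2 ≤
          ENNReal.ofReal C * ∫⁻ z in Metric.closedBall x₀ r, ‖polyFun q z‖ₑ ^ 2 ∧
        ENNReal.ofReal (r ^ 4) * ‖fderiv ℝ (polyFun q) x‖ₑ ^ 2 ≤
          ENNReal.ofReal C * ∫⁻ z in Metric.closedBall x₀ r, ‖polyFun q z‖ₑ ^ 2 := by
  obtain ⟨C, hC, h⟩ := exists_polyFun_bound_unitDisc k κ
  refine ⟨C, hC, fun q hq x₀ r hr x hx => ?_⟩
  obtain ⟨q', hq', hqq'⟩ := exists_polyFun_affine q x₀ r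
  set z : Plane := r⁻¹ • (x - x₀) with hz
  have hxz : x₀ + r • z = x := by rw [hz, smul_inv_smul₀ hr.ne']; abel
  have hzm : z ∈ Metric.closedBall (0 : Plane) κ := by
    rw [mem_closedBall_zero_iff, hz, norm_smul, norm_inv, Real.norm_of_nonneg hr.le,
      inv_mul_le_iff₀ hr, mul_comm, ← dist_eq_norm]
    exact hx
  obtain ⟨h0, h1⟩ := h q' (hq'.trans hq) z hzm
  have hI : ENNReal.ofReal (r ^ 2) * ∫⁻ z in unitDisc, ‖polyFun q' z‖ₑ ^ 2 =
      ∫⁻ z in Metric.closedBall x₀ r, ‖polyFun q z‖ₑ ^ 2 := by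
    simp_rw [hqq']
    exact lintegral_unitDisc_comp_affine (fun x => ‖polyFun q x‖ₑ ^ 2) x₀ hr
  -- The chain rule costs one factor `r`, hence `r²` after squaring; with the Jacobian this makes
  -- the power `r⁴`.
  have hfd : fderiv ℝ (polyFun q') z = r • fderiv ℝ (polyFun q) x := by
    have : polyFun q' = polyFun q ∘ fun z => x₀ + r • z := funext hqq'
    have hd : HasFDerivAt (fun z : Plane => x₀ + r • z)
        (r • ContinuousLinearMap.id ℝ Plane) z :=
      ((hasFDerivAt_id z).const_smul r).const_add x₀
    have hp : HasFDerivAt (polyFun q) (fderiv ℝ (polyFun q) x) (x₀ + r • z) := by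
      rw [hxz]; exact (differentiable_polyFun q x).hasFDerivAt
    rw [this, (hp.comp z hd).fderiv]
    ext; simp
  rw [hqq', hxz] at h0
  rw [hfd, enorm_smul, mul_pow] at h1
  constructor
  · calc _ ≤ ENNReal.ofReal (r ^ 2) * (ENNReal.ofReal C * ∫⁻ z in unitDisc, ‖polyFun q' z‖ₑ ^ 2) := by
          gcongr
      _ = _ := by rw [mul_left_comm, hI]
  · calc _ = ENNReal.ofReal (r ^ 2) * (‖r‖ₑ ^ 2 * ‖fderiv ℝ (polyFun q) x‖ₑ ^ 2) := by
          rw [← mul_assoc, Real.enorm_of_nonneg hr.le, ← ENNReal.ofReal_pow hr.le,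
            ← ENNReal.ofReal_mul (by positivity), ← pow_add]
      _ ≤ ENNReal.ofReal (r ^ 2) * (ENNReal.ofReal C * ∫⁻ z in unitDisc, ‖polyFun q' z‖ₑ ^ 2) := by
          gcongr
      _ = _ := by rw [mul_left_comm, hI]

/-! ### Geometry of triangles -/

lemma isCompact_hull (t : Finset Plane) : IsCompact (hull t) :=
  t.finite_toSet.isCompact_convexHull ℝ

lemma convex_hull (t : Finset Plane) : Convex ℝ (hull t) := convex_convexHull ℝ _

lemma measurableSet_hull (t : Finset Plane) : MeasurableSet (hull t) :=
  (isCompact_hull t).isClosed.measurableSet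

lemma hull_mono {e t : Finset Plane} (h : e ⊆ t) : hull e ⊆ hull t :=
  convexHull_mono (Finset.coe_subset.2 h)

lemma mem_hull {t : Finset Plane} {a : Plane} (h : a ∈ t) : a ∈ hull t :=
  subset_convexHull ℝ _ h

lemma dist_le_diam {t : Finset Plane} {x y : Plane} (hx : x ∈ hull t) (hy : y ∈ hull t) :
    dist x y ≤ diam t :=
  Metric.dist_le_diam_of_mem (isCompact_hull t).isBounded hx hy

lemma diam_nonneg (t : Finset Plane) : 0 ≤ diam t := Metric.diam_nonneg

lemma hull_subset_closedBall {t : Finset Plane} {x : Plane} (hx : x ∈ hull t) :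
    hull t ⊆ Metric.closedBall x (diam t) :=
  fun _ hy => dist_le_diam hy hx

lemma mem_edges {t e : Finset Plane} : e ∈ edges t ↔ e ⊆ t ∧ e.card = 2 :=
  Finset.mem_powersetCard

lemma card_edges {t : Finset Plane} (ht : t.card = 3) : (edges t).card = 3 := by
  rw [edges, Finset.card_powersetCard, ht]; rfl

lemma hull_pair {e : Finset Plane} {a b : Plane} [DecidableEq Plane] (h : e = {a, b}) :
    hull e = segment ℝ a b := by
  rw [hull, h, Finset.coe_pair, convexHull_pair]

lemma arc_univ_le {t e : Finset Plane} (he : e ∈ edges t) :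
    arc e Set.univ ≤ ENNReal.ofReal (diam t) := by
  classical
  obtain ⟨hsub, hcard⟩ := mem_edges.1 he
  obtain ⟨a, b, -, rfl⟩ := Finset.card_eq_two.1 hcard
  rw [arc, Measure.restrict_apply_univ, hull_pair rfl, hausdorffMeasure_segment, edist_dist]
  exact ENNReal.ofReal_le_ofReal
    (dist_le_diam (mem_hull (hsub (by simp))) (mem_hull (hsub (by simp))))

lemma exists_unit_orthogonal {w : Plane} (hw : w ≠ 0) :
    ∃ u : Plane, ‖u‖ = 1 ∧ inner ℝ u w = 0 := by
  set v : Plane := !₂[-w 1, w 0] with hv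
  have hv0 : v ≠ 0 := by
    intro h
    apply hw
    ext i
    have h0 := congrArg (fun z : Plane => z 0) h
    have h1 := congrArg (fun z : Plane => z 1) h
    fin_cases i
    · simpa [hv] using h1
    · simpa [hv] using h0
  refine ⟨‖v‖⁻¹ • v, by rw [norm_smul, norm_inv, norm_norm, inv_mul_cancel₀ (norm_ne_zero_iff.2 hv0)],
    ?_⟩
  rw [inner_smul_left]
  simp [hv, PiLp.inner_apply, Fin.sum_univ_two]
  right; ring

/-- Every edge of a triangle is at least as long as the diameter of an inscribed disc. -/
lemma two_mul_le_dist {t : Finset Plane} (ht : t.card = 3) {a b : Plane} (ha : a ∈ t) (hb : b ∈ t)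
    (hab : a ≠ b) {x : Plane} {r : ℝ} (hr : 0 < r) (hx : Metric.closedBall x r ⊆ hull t) :
    2 * r ≤ dist a b := by
  classical
  obtain ⟨c, hc⟩ : ∃ c, (t.erase a).erase b = {c} := by
    rw [← Finset.card_eq_one, Finset.card_erase_of_mem (Finset.mem_erase.2 ⟨hab.symm, hb⟩),
      Finset.card_erase_of_mem ha, ht]
  have htc : ∀ v ∈ t, v = a ∨ v = b ∨ v = c := by
    intro v hv
    by_contra! h
    have : v ∈ (t.erase a).erase b := by simp [h, hv]
    rw [hc, Finset.mem_singleton] at this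
    exact h.2.2 this
  have hca : c - a ≠ 0 := by
    have : c ∈ (t.erase a).erase b := by simp [hc]
    simp only [Finset.mem_erase] at this
    exact sub_ne_zero.2 this.2.1
  -- Projecting along the side `ac` onto its normal `u` sends `c` and `a` to the same point, so the
  -- image of the triangle is the interval between the images of `a` and `b`. It contains the image
  -- of the disc, of length `2r`.
  obtain ⟨u, hu, hu0⟩ := exists_unit_orthogonal hca
  rw [inner_sub_right, sub_eq_zero] at hu0
  have hsub : hull t ⊆ {y | inner ℝ u y ∈ Set.uIcc (inner ℝ u a) (inner ℝ u b)} := by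
    refine convexHull_min (fun v hv => ?_) ?_
    · rcases htc v hv with rfl | rfl | rfl
      · exact Set.left_mem_uIcc
      · exact Set.right_mem_uIcc
      · rw [Set.mem_ofPred_eq, hu0]; exact Set.left_mem_uIcc
    · exact (convex_uIcc _ _).linear_preimage (innerₛₗ ℝ u)
  have h1 : inner ℝ u (x + r • u) ∈ Set.uIcc (inner ℝ u a) (inner ℝ u b) := hsub (hx (by
    rw [mem_closedBall_iff_norm, add_sub_cancel_left, norm_smul, hu, Real.norm_of_nonneg hr.le,
      mul_one]))
  have h2 : inner ℝ u (x - r • u) ∈ Set.uIcc (inner ℝ u a) (inner ℝ u b) := hsub (hx (by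
    rw [mem_closedBall_iff_norm, sub_sub_cancel_left, norm_neg, norm_smul, hu,
      Real.norm_of_nonneg hr.le, mul_one]))
  have h3 := Set.abs_sub_le_of_uIcc_subset_uIcc (Set.uIcc_subset_uIcc h2 h1)
  rw [← inner_sub_right, ← inner_sub_right, add_sub_sub_cancel, ← two_smul ℝ (r • u),
    inner_smul_right, inner_smul_right, real_inner_self_eq_norm_sq, hu] at h3
  calc 2 * r ≤ |2 * (r * 1 ^ 2)| := by rw [one_pow, mul_one]; exact le_abs_self _
    _ ≤ |inner ℝ u (b - a)| := h3
    _ ≤ ‖u‖ * ‖b - a‖ := abs_real_inner_le_norm _ _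
    _ = dist a b := by rw [hu, one_mul, dist_comm, dist_eq_norm]

lemma volume_hull_of_card_le_two {t : Finset Plane} (ht : t.card ≤ 2) : volume (hull t) = 0 := by
  classical
  rcases t.eq_empty_or_nonempty with rfl | hne
  · simp [hull]
  have hcard : t.card = (t.card - 1) + 1 := by have := hne.card_pos; omega
  refine measure_mono_null (convexHull_subset_affineSpan _) ?_
  refine Measure.addHaar_affineSubspace _ _ fun htop => ?_
  have h1 := finrank_vectorSpan_image_finset_le ℝ (id : Plane → Plane) t hcard
  have h2 : vectorSpan ℝ (t : Set Plane) = ⊤ := by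
    rw [← direction_affineSpan, htop, AffineSubspace.direction_top]
  rw [Finset.image_id] at h1
  rw [h2, finrank_top, finrank_euclideanSpace_fin] at h1
  omega

section Triangulation

variable {D : Set Plane} (K : Triangulation D)

/-- Distinct triangles share at most two vertices, so by conformity they meet in a set contained in
a line. -/
lemma Triangulation.aedisjoint_hull :
    Set.Pairwise (K.triangles : Set (Finset Plane)) (Function.onFun (AEDisjoint volume) hull) := by
  classical
  intro s hs t ht hst
  have h := K.conforming s hs t ht
  rw [← Finset.coe_inter] at h
  change volume (hull s ∩ hull t) = 0
  rw [show hull s ∩ hull t = hull (s ∩ t) from h]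
  refine volume_hull_of_card_le_two ?_
  by_contra! hlt
  have h1 : s ∩ t = s := Finset.eq_of_subset_of_card_le Finset.inter_subset_left
    (by rw [K.card_eq s hs]; omega)
  have h2 : s ∩ t = t := Finset.eq_of_subset_of_card_le Finset.inter_subset_right
    (by rw [K.card_eq t ht]; omega)
  exact hst (h1.symm.trans h2)

lemma Triangulation.hull_subset_closure {t : Finset Plane} (ht : t ∈ K.triangles) :
    hull t ⊆ closure D := by
  rw [← K.cover]
  exact Set.subset_biUnion_of_mem (u := fun t : Finset Plane => convexHull ℝ (t : Set Plane)) ht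

lemma Triangulation.interior_hull_subset {t : Finset Plane} (ht : t ∈ K.triangles) :
    interior (hull t) ⊆ D := by
  rw [← K.regular]
  exact interior_mono (K.hull_subset_closure ht)

lemma Triangulation.isOpen (K : Triangulation D) : IsOpen D :=
  K.regular ▸ isOpen_interior

lemma Triangulation.interior_hull_nonempty {t : Finset Plane} (ht : t ∈ K.triangles) :
    (interior (hull t)).Nonempty := by
  rw [hull, interior_convexHull_nonempty_iff_affineSpan_eq_top]
  have h := (K.indep t ht).affineSpan_eq_top_iff_card_eq_finrank_add_one.2
    (by simp [K.card_eq t ht])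
  simpa using h

lemma Triangulation.uniqueDiffOn_hull {t : Finset Plane} (ht : t ∈ K.triangles) :
    UniqueDiffOn ℝ (hull t) :=
  uniqueDiffOn_convex (convex_hull t) (K.interior_hull_nonempty ht)

lemma interior_hull_ae_eq (t : Finset Plane) :
    interior (hull t) =ᵐ[volume] hull t :=
  interior_ae_eq_of_null_frontier ((convex_hull t).addHaar_frontier volume)

variable {K}

lemma Triangulation.mem_neighbours {t e t' : Finset Plane} :
    t' ∈ K.neighbours t e ↔ t' ∈ K.triangles ∧ t' ≠ t ∧ e ⊆ t' := by
  simp [Triangulation.neighbours]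

lemma Triangulation.mem_interiorEdges {t e : Finset Plane} :
    e ∈ K.interiorEdges t ↔ e ∈ edges t ∧ (K.neighbours t e).Nonempty := by
  simp [Triangulation.interiorEdges]

/-- Chains `h_T ≤ κ r` with the bound of `2r` by any edge length; edges shared by two triangles then
make their diameters comparable. -/
lemma Triangulation.ShapeRegular.diam_le {κ : ℝ} (hK : K.ShapeRegular κ) (hκ : 0 < κ)
    {t : Finset Plane} (ht : t ∈ K.triangles) {a b : Plane} (ha : a ∈ t) (hb : b ∈ t)
    (hab : a ≠ b) : diam t ≤ κ / 2 * dist a b := by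
  obtain ⟨x, r, hr, hx, hd⟩ := hK t ht
  have := two_mul_le_dist (K.card_eq t ht) ha hb hab hr hx
  nlinarith

/-- The number of triangles at an edge is bounded in terms of the shape regularity. -/
lemma Triangulation.ShapeRegular.card_neighbours_le {κ : ℝ} (hK : K.ShapeRegular κ) (hκ : 0 < κ)
    {t e : Finset Plane} (he : e ∈ edges t) :
    ((K.neighbours t e).card : ℝ) ≤ κ ^ 4 / 4 := by
  classical
  obtain ⟨-, hcard⟩ := mem_edges.1 he
  obtain ⟨a, b, hab, rfl⟩ := Finset.card_eq_two.1 hcard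
  set S := K.neighbours t {a, b}
  set l := dist a b
  have hl : 0 < l := dist_pos.2 hab
  have hS : ∀ s ∈ S, s ∈ K.triangles ∧ a ∈ s ∧ b ∈ s := fun s hs => by
    obtain ⟨h1, -, h2⟩ := mem_neighbours.1 hs
    exact ⟨h1, h2 (by simp), h2 (by simp)⟩
  set v := (volume : Measure Plane) (Metric.ball 0 1)
  have hv0 : v ≠ 0 := (Metric.measure_ball_pos _ _ one_pos).ne'
  have hvtop : v ≠ ⊤ := measure_ball_lt_top.ne
  -- Each neighbour contains a disc of radius `l / κ`, all lie in the disc of radius `κ l / 2` about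
  -- `a`, and they are almost disjoint. The ratio of the areas is `κ⁴ / 4`.
  have hlow : ∀ s ∈ S, ENNReal.ofReal ((l / κ) ^ 2) * v ≤ volume (hull s) := by
    intro s hs
    obtain ⟨hst, has, hbs⟩ := hS s hs
    obtain ⟨x, r, hr, hx, hd⟩ := hK s hst
    have hlr : l / κ ≤ r := by
      rw [div_le_iff₀ hκ, mul_comm]
      exact (dist_le_diam (mem_hull has) (mem_hull hbs)).trans hd
    calc _ = volume (Metric.closedBall x (l / κ)) := by
          rw [Measure.addHaar_closedBall _ _ (by positivity), finrank_euclideanSpace_fin]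
      _ ≤ _ := measure_mono ((Metric.closedBall_subset_closedBall hlr).trans hx)
  have hup : volume (⋃ s ∈ S, hull s) ≤ ENNReal.ofReal ((κ / 2 * l) ^ 2) * v := by
    calc _ ≤ volume (Metric.closedBall a (κ / 2 * l)) := by
          refine measure_mono (Set.iUnion₂_subset fun s hs => ?_)
          obtain ⟨hst, has, hbs⟩ := hS s hs
          exact (hull_subset_closedBall (mem_hull has)).trans
            (Metric.closedBall_subset_closedBall (hK.diam_le hκ hst has hbs hab))
      _ = _ := by
          rw [Measure.addHaar_closedBall _ _ (by positivity), finrank_euclideanSpace_fin]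
  rw [measure_biUnion_finset₀
    (K.aedisjoint_hull.mono fun s hs => (hS s hs).1)
    (fun s _ => (measurableSet_hull s).nullMeasurableSet)] at hup
  have h := (Finset.card_nsmul_le_sum S _ _ hlow).trans hup
  rw [nsmul_eq_mul, ← mul_assoc, ENNReal.mul_le_mul_iff_left hv0 hvtop,
    ← ENNReal.ofReal_natCast, ← ENNReal.ofReal_mul (by positivity),
    ENNReal.ofReal_le_ofReal_iff (by positivity)] at h
  have h' : (S.card : ℝ) * (l / κ) ^ 2 ≤ κ ^ 4 / 4 * (l / κ) ^ 2 := by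
    refine h.trans_eq ?_
    field_simp
    norm_num
  exact le_of_mul_le_mul_right h' (by positivity)

end Triangulation

/-! ### Inverse estimates -/

lemma enorm_sq_eq_ofReal {F : Type*} [NormedAddCommGroup F] (x : F) :
    ‖x‖ₑ ^ 2 = ENNReal.ofReal (‖x‖ ^ 2) := by
  rw [← ofReal_norm, ENNReal.ofReal_pow (norm_nonneg _)]

lemma enorm_sq_eq_sum (x : Plane) : ‖x‖ₑ ^ 2 = ∑ i, ‖x i‖ₑ ^ 2 := by
  simp only [enorm_sq_eq_ofReal]
  rw [EuclideanSpace.norm_sq_eq, ENNReal.ofReal_sum_of_nonneg fun i _ => by positivity]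

lemma enorm_inner_sq_le {u : Plane} (hu : ‖u‖ = 1) (x : Plane) :
    ‖(inner ℝ x u : ℝ)‖ₑ ^ 2 ≤ ‖x‖ₑ ^ 2 := by
  simp only [enorm_sq_eq_ofReal]
  refine ENNReal.ofReal_le_ofReal (pow_le_pow_left₀ (norm_nonneg _) ?_ 2)
  simpa [hu] using norm_inner_le_norm (𝕜 := ℝ) x u

lemma enorm_sum_sq_le {ι F : Type*} [NormedAddCommGroup F] (s : Finset ι) (g : ι → F) :
    ‖∑ i ∈ s, g i‖ₑ ^ 2 ≤ s.card * ∑ i ∈ s, ‖g i‖ₑ ^ 2 := by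
  simp only [enorm_sq_eq_ofReal]
  rw [← ENNReal.ofReal_sum_of_nonneg fun i _ => by positivity, ← ENNReal.ofReal_natCast,
    ← ENNReal.ofReal_mul (by positivity)]
  refine ENNReal.ofReal_le_ofReal ?_
  exact (pow_le_pow_left₀ (norm_nonneg _) (norm_sum_le _ _) 2).trans sq_sum_le_card_mul_sum_sq

lemma enorm_sub_sq_le {F : Type*} [NormedAddCommGroup F] (x y : F) :
    ‖x - y‖ₑ ^ 2 ≤ 2 * (‖x‖ₑ ^ 2 + ‖y‖ₑ ^ 2) := by
  have h := enorm_sum_sq_le Finset.univ ![x, -y]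
  simpa [Fin.sum_univ_two, ← sub_eq_add_neg] using h

section Derivatives

variable {S : Set Plane} {ξ : Plane → Plane} {q : Fin 2 → MvPolynomial (Fin 2) ℝ}

lemma differentiableWithinAt_of_eqOn_polyFun (hq : ∀ i, Set.EqOn (fun x => ξ x i) (polyFun (q i)) S)
    {y : Plane} (hy : y ∈ S) : DifferentiableWithinAt ℝ ξ S y := by
  rw [differentiableWithinAt_euclidean]
  exact fun i => (differentiable_polyFun (q i) y).differentiableWithinAt.congr (hq i) (hq i hy)

/-- The field is polynomial only on `S`, so unique differentiability is what identifies its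
derivative within `S` with that of the polynomial, boundary points included. -/
lemma fderivWithin_apply_of_eqOn_polyFun (hS : UniqueDiffOn ℝ S)
    (hq : ∀ i, Set.EqOn (fun x => ξ x i) (polyFun (q i)) S) {y : Plane} (hy : y ∈ S) (v : Plane)
    (i : Fin 2) : (fderivWithin ℝ ξ S y v) i = fderiv ℝ (polyFun (q i)) y v := by
  have h1 := (differentiableWithinAt_of_eqOn_polyFun hq hy).hasFDerivWithinAt
  have h2 := (hasFDerivWithinAt_euclidean.1 h1) i
  have h3 := ((differentiable_polyFun (q i) y).hasFDerivAt.hasFDerivWithinAt (s := S)).congr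
    (hq i) (hq i hy)
  exact congrArg (fun L : Plane →L[ℝ] ℝ => L v) ((hS y hy).eq h2 h3)

lemma divWithin_of_eqOn_polyFun (hS : UniqueDiffOn ℝ S)
    (hq : ∀ i, Set.EqOn (fun x => ξ x i) (polyFun (q i)) S) {y : Plane} (hy : y ∈ S) :
    divWithin S ξ y = ∑ i, fderiv ℝ (polyFun (q i)) y (EuclideanSpace.single i 1) :=
  Finset.sum_congr rfl fun i _ => fderivWithin_apply_of_eqOn_polyFun hS hq hy _ i

end Derivatives

/-- Pointwise bounds of a polynomial field and its divergence on a triangle by its `L²` norm. -/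
lemma exists_field_bound (k : ℕ) {κ : ℝ} (hκ : 0 < κ) :
    ∃ C : ℝ, 0 < C ∧ ∀ (t : Finset Plane), UniqueDiffOn ℝ (hull t) →
      ∀ (x : Plane) (r : ℝ), 0 < r → Metric.closedBall x r ⊆ hull t → diam t ≤ κ * r →
      ∀ ξ : Plane → Plane, (∀ i : Fin 2, IsPolyOn k (hull t) (fun y => ξ y i)) → ∀ y ∈ hull t,
        ENNReal.ofReal (diam t) ^ 2 * ‖ξ y‖ₑ ^ 2 ≤ ENNReal.ofReal C * sqNorm (area t) ξ ∧
        ENNReal.ofReal (diam t) ^ 4 * ‖divWithin (hull t) ξ y‖ₑ ^ 2 ≤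
          ENNReal.ofReal C * sqNorm (area t) ξ := by
  obtain ⟨C, hC, h⟩ := exists_polyFun_bound k κ
  -- The first summand serves the field (two components), the second the divergence (a factor 2 from
  -- Cauchy–Schwarz and 2 from the number of terms).
  refine ⟨2 * κ ^ 2 * C + 4 * κ ^ 4 * C, by positivity, ?_⟩
  intro t hS x r hr hx hd ξ hξ y hy
  choose q hqd hqe using hξ
  have hq : ∀ i, Set.EqOn (fun x => ξ x i) (polyFun (q i)) (hull t) := hqe
  have hyx : y ∈ Metric.closedBall x (κ * r) :=
    Metric.closedBall_subset_closedBall hd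
      (hull_subset_closedBall (hx (Metric.mem_closedBall_self hr.le)) hy)
  have hint : ∀ i, ∫⁻ z in Metric.closedBall x r, ‖polyFun (q i) z‖ₑ ^ 2 ≤ sqNorm (area t) ξ := by
    intro i
    calc _ = ∫⁻ z in Metric.closedBall x r, ‖ξ z i‖ₑ ^ 2 :=
          setLIntegral_congr_fun Metric.isClosed_closedBall.measurableSet
            fun z hz => by rw [← hq i (hx hz)]
      _ ≤ ∫⁻ z in Metric.closedBall x r, ‖ξ z‖ₑ ^ 2 := by
          refine lintegral_mono fun z => ?_
          rw [enorm_sq_eq_sum (ξ z)]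
          exact Finset.single_le_sum (f := fun i => ‖ξ z i‖ₑ ^ 2) (fun _ _ => zero_le)
            (Finset.mem_univ i)
      _ ≤ _ := lintegral_mono_set hx
  have hpow : ∀ m : ℕ, ENNReal.ofReal (diam t) ^ m ≤
      ENNReal.ofReal (κ ^ m) * ENNReal.ofReal (r ^ m) := fun m => by
    rw [← ENNReal.ofReal_mul (by positivity), ← mul_pow, ← ENNReal.ofReal_pow (diam_nonneg t)]
    exact ENNReal.ofReal_le_ofReal (pow_le_pow_left₀ (diam_nonneg t) hd m)
  set S := sqNorm (area t) ξ
  have h0 : ∀ i, ENNReal.ofReal (diam t) ^ 2 * ‖ξ y i‖ₑ ^ 2 ≤ ENNReal.ofReal (κ ^ 2 * C) * S := by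
    intro i
    have := (h (q i) (hqd i) x r hr y hyx).1
    rw [show ξ y i = polyFun (q i) y from hq i hy]
    calc _ ≤ ENNReal.ofReal (κ ^ 2) * ENNReal.ofReal (r ^ 2) * ‖polyFun (q i) y‖ₑ ^ 2 := by
          gcongr; exact hpow 2
      _ ≤ ENNReal.ofReal (κ ^ 2) * (ENNReal.ofReal C * S) := by
          rw [mul_assoc]
          exact mul_le_mul_right (this.trans (mul_le_mul_right (hint i) _)) _
      _ = _ := by rw [← mul_assoc, ← ENNReal.ofReal_mul (by positivity)]
  have h1 : ∀ i, ENNReal.ofReal (diam t) ^ 4 *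
      ‖fderiv ℝ (polyFun (q i)) y (EuclideanSpace.single i 1)‖ₑ ^ 2 ≤
        ENNReal.ofReal (κ ^ 4 * C) * S := by
    intro i
    have := (h (q i) (hqd i) x r hr y hyx).2
    have hn : ‖fderiv ℝ (polyFun (q i)) y (EuclideanSpace.single i 1)‖ₑ ≤
        ‖fderiv ℝ (polyFun (q i)) y‖ₑ := by
      refine ((fderiv ℝ (polyFun (q i)) y).le_opENorm _).trans_eq ?_
      rw [← ofReal_norm (EuclideanSpace.single i (1 : ℝ)), PiLp.norm_single]
      simp
    calc _ ≤ ENNReal.ofReal (κ ^ 4) * ENNReal.ofReal (r ^ 4) *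
            ‖fderiv ℝ (polyFun (q i)) y‖ₑ ^ 2 := by
          gcongr; exact hpow 4
      _ ≤ ENNReal.ofReal (κ ^ 4) * (ENNReal.ofReal C * S) := by
          rw [mul_assoc]
          exact mul_le_mul_right (this.trans (mul_le_mul_right (hint i) _)) _
      _ = _ := by rw [← mul_assoc, ← ENNReal.ofReal_mul (by positivity)]
  constructor
  · rw [enorm_sq_eq_sum, Finset.mul_sum]
    refine (Finset.sum_le_sum fun i _ => h0 i).trans ?_
    rw [Finset.sum_const, Finset.card_univ, Fintype.card_fin, nsmul_eq_mul, ← mul_assoc]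
    gcongr
    rw [← ENNReal.ofReal_natCast, ← ENNReal.ofReal_mul (by positivity)]
    refine ENNReal.ofReal_le_ofReal ?_
    have : 0 ≤ κ ^ 4 * C := by positivity
    push_cast
    linarith
  · rw [divWithin_of_eqOn_polyFun hS hq hy]
    refine (mul_le_mul_right (enorm_sum_sq_le _ _) _).trans ?_
    rw [mul_left_comm, Finset.mul_sum]
    refine (mul_le_mul_right (Finset.sum_le_sum fun i _ => h1 i) _).trans ?_
    rw [Finset.sum_const, Finset.card_univ, Fintype.card_fin, nsmul_eq_mul, ← mul_assoc,
      ← mul_assoc]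
    gcongr
    rw [← ENNReal.ofReal_natCast, ← ENNReal.ofReal_mul (by positivity),
      ← ENNReal.ofReal_mul (by positivity)]
    refine ENNReal.ofReal_le_ofReal ?_
    have : 0 ≤ κ ^ 2 * C := by positivity
    push_cast
    linarith

lemma diam_pos {t : Finset Plane} (ht : t.card = 3) : 0 < diam t := by
  obtain ⟨a, ha, b, hb, hab⟩ := Finset.one_lt_card.1 (by omega : 1 < t.card)
  exact (dist_pos.2 hab).trans_le (dist_le_diam (mem_hull ha) (mem_hull hb))

/-- Integrates `|g|² ≤ B / h²` over an edge of length at most `h`. -/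
lemma diam_mul_sqNorm_arc_le {F : Type*} [NormedAddCommGroup F] {t e : Finset Plane}
    (ht : t.card = 3) (he : e ∈ edges t) {g : Plane → F} {B : ℝ≥0∞}
    (hg : ∀ y ∈ hull e, ENNReal.ofReal (diam t) ^ 2 * ‖g y‖ₑ ^ 2 ≤ B) :
    ENNReal.ofReal (diam t) * sqNorm (arc e) g ≤ B := by
  set h := ENNReal.ofReal (diam t)
  have h0 : h ^ 2 ≠ 0 := pow_ne_zero _ (by simpa [h] using diam_pos ht)
  have htop : h ^ 2 ≠ ⊤ := ENNReal.pow_ne_top ENNReal.ofReal_ne_top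
  calc _ ≤ h * ∫⁻ _, B / h ^ 2 ∂(arc e) := by
        refine mul_le_mul_right (lintegral_mono_ae ?_) _
        filter_upwards [ae_restrict_mem (measurableSet_hull e)] with y hy
        rw [ENNReal.le_div_iff_mul_le (Or.inl h0) (Or.inl htop), mul_comm]
        exact hg y hy
    _ ≤ h * (B / h ^ 2 * h) := by
        rw [lintegral_const]
        gcongr
        exact arc_univ_le he
    _ = B / h ^ 2 * h ^ 2 := by ring
    _ = B := ENNReal.div_mul_cancel h0 htop

/-- Integrates `|g|² ≤ B / h⁴` over the triangle, which lies in a disc of radius `h` about a vertex.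
-/
lemma diam_sq_mul_sqNorm_area_le {F : Type*} [NormedAddCommGroup F] {t : Finset Plane}
    (ht : t.card = 3) {g : Plane → F} {B : ℝ≥0∞}
    (hg : ∀ y ∈ hull t, ENNReal.ofReal (diam t) ^ 4 * ‖g y‖ₑ ^ 2 ≤ B) :
    ENNReal.ofReal (diam t) ^ 2 * sqNorm (area t) g ≤
      volume (Metric.ball (0 : Plane) 1) * B := by
  set h := ENNReal.ofReal (diam t) with hh
  have h0 : h ^ 4 ≠ 0 := pow_ne_zero _ (by simpa [h] using diam_pos ht)
  have htop : h ^ 4 ≠ ⊤ := ENNReal.pow_ne_top ENNReal.ofReal_ne_top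
  have hvol : volume (hull t) ≤ h ^ 2 * volume (Metric.ball (0 : Plane) 1) := by
    obtain ⟨a, ha⟩ := Finset.card_pos.1 (by omega : 0 < t.card)
    refine (measure_mono (hull_subset_closedBall (mem_hull ha))).trans_eq ?_
    rw [Measure.addHaar_closedBall _ _ (diam_nonneg t), finrank_euclideanSpace_fin, hh,
      ENNReal.ofReal_pow (diam_nonneg t)]
  calc _ ≤ h ^ 2 * ∫⁻ _, B / h ^ 4 ∂(area t) := by
        refine mul_le_mul_right (lintegral_mono_ae ?_) _
        filter_upwards [ae_restrict_mem (measurableSet_hull t)] with y hy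
        rw [ENNReal.le_div_iff_mul_le (Or.inl h0) (Or.inl htop), mul_comm]
        exact hg y hy
    _ ≤ h ^ 2 * (B / h ^ 4 * (h ^ 2 * volume (Metric.ball (0 : Plane) 1))) := by
        rw [lintegral_const, area, Measure.restrict_apply_univ]
        gcongr
    _ = volume (Metric.ball (0 : Plane) 1) * (B / h ^ 4 * h ^ 4) := by ring
    _ = _ := by rw [ENNReal.div_mul_cancel h0 htop]

section Neighbours

variable {D : Set Plane} {K : Triangulation D}

/-- Being neighbours across `e` is a symmetric relation, so the two triangles can be exchanged. -/
lemma Triangulation.sum_neighbours_comm {A : Type*} [AddCommMonoid A] (g : Finset Plane → A) :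
    ∑ t ∈ K.triangles, ∑ e ∈ edges t, ∑ t' ∈ K.neighbours t e, g t' =
      ∑ t ∈ K.triangles, ∑ e ∈ edges t, ∑ _t' ∈ K.neighbours t e, g t := by
  simp only [Finset.sum_sigma']
  refine Finset.sum_bij' (fun x _ => ⟨x.2.2, x.2.1, x.1⟩) (fun x _ => ⟨x.2.2, x.2.1, x.1⟩)
    ?_ ?_ (fun _ _ => rfl) (fun _ _ => rfl) (fun _ _ => rfl)
  all_goals
    rintro ⟨t, e, t'⟩ h
    simp only [Finset.mem_sigma, mem_neighbours, mem_edges] at h ⊢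
    exact ⟨h.2.2.1, ⟨h.2.2.2.2, h.2.1.2⟩, h.1, h.2.2.2.1.symm, h.2.1.1⟩

lemma Triangulation.enorm_jump_sq_le {n : Finset Plane → Plane} (hn : K.IsUnitNormal n)
    (ξ : Finset Plane → Plane → Plane) {t e : Finset Plane} (ht : t ∈ K.triangles)
    (he : e ∈ edges t) (x : Plane) :
    ‖K.jump n ξ t e x‖ₑ ^ 2 ≤ (K.neighbours t e).card *
      ∑ t' ∈ K.neighbours t e, 2 * (‖ξ t x‖ₑ ^ 2 + ‖ξ t' x‖ₑ ^ 2) := by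
  refine (enorm_sum_sq_le _ _).trans ?_
  gcongr with t' ht'
  exact (enorm_inner_sq_le (hn t ht e he).1 _).trans (enorm_sub_sq_le _ _)

end Neighbours

/-- The inverse estimates hold with a constant that depends only on the polynomial degree and the
shape regularity. -/
lemma exists_inverseEstimates (k : ℕ) {κ : ℝ} (hκ : 0 < κ) :
    ∃ c : ℝ, 0 < c ∧ ∀ (D : Set Plane) (K : Triangulation D), K.ShapeRegular κ →
      ∀ n : Finset Plane → Plane, K.IsUnitNormal n → K.InverseEstimates n k c := by
  obtain ⟨C, hC, h⟩ := exists_field_bound k hκ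
  set v : ℝ := (volume (Metric.ball (0 : Plane) 1)).toReal
  have hv : volume (Metric.ball (0 : Plane) 1) = ENNReal.ofReal v :=
    (ENNReal.ofReal_toReal measure_ball_lt_top.ne).symm
  have hv0 : 0 ≤ v := ENNReal.toReal_nonneg
  set N : ℝ := κ ^ 4 / 4
  -- The factor 2 is from squaring a difference, `(κ / 2)²` from replacing `h_T` by the diameter of
  -- the neighbour.
  set B : ℝ := 2 * C * (1 + (κ / 2) ^ 2)
  have hN : 0 ≤ N := by positivity
  have hB : 0 ≤ B := by positivity
  -- The summands cover the trace (three edges), the divergence and the jumps. The leading 1 gives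
  -- `c ≤ c²`, so linear bounds suffice for the squared estimates.
  set c : ℝ := 1 + 3 * C + v * C + 6 * (N * N * B) with hc
  have hNB : 0 ≤ N * N * B := by positivity
  have hvC : 0 ≤ v * C := by positivity
  have hc1 : 1 ≤ c := by linarith
  have hle : ∀ (a : ℝ) (S : ℝ≥0∞), a ≤ c →
      ENNReal.ofReal a * S ≤ ENNReal.ofReal c ^ 2 * S := fun a S ha => by
    rw [← ENNReal.ofReal_pow (by linarith)]
    gcongr
    nlinarith
  refine ⟨c, by linarith, fun D K hK n hn => ?_⟩
  have hpt : ∀ ξ, K.IsPolyField k ξ → ∀ t ∈ K.triangles, ∀ y ∈ hull t,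
      ENNReal.ofReal (diam t) ^ 2 * ‖ξ t y‖ₑ ^ 2 ≤ ENNReal.ofReal C * sqNorm (area t) (ξ t) ∧
      ENNReal.ofReal (diam t) ^ 4 * ‖divWithin (hull t) (ξ t) y‖ₑ ^ 2 ≤
          ENNReal.ofReal C * sqNorm (area t) (ξ t) := by
    intro ξ hξ t ht
    obtain ⟨x, r, hr, hx, hd⟩ := hK t ht
    exact h t (K.uniqueDiffOn_hull ht) x r hr hx hd (ξ t) (hξ t ht)
  refine ⟨fun ξ hξ t ht => ?_, fun ξ hξ t ht => ?_, fun ξ hξ => ?_⟩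
  · have hsub : K.interiorEdges t ⊆ edges t := fun e he =>
      (Triangulation.mem_interiorEdges.1 he).1
    rw [Finset.mul_sum]
    calc _ ≤ ∑ _e ∈ edges t, ENNReal.ofReal C * sqNorm (area t) (ξ t) := by
          refine (Finset.sum_le_sum_of_subset hsub).trans (Finset.sum_le_sum fun e he => ?_)
          refine diam_mul_sqNorm_arc_le (K.card_eq t ht) he fun y hy => ?_
          refine le_trans ?_ (hpt ξ hξ t ht y (hull_mono (mem_edges.1 he).1 hy)).1
          exact mul_le_mul_right (enorm_inner_sq_le (hn t ht e he).1 _) _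
      _ = ENNReal.ofReal (3 * C) * sqNorm (area t) (ξ t) := by
          rw [Finset.sum_const, card_edges (K.card_eq t ht), nsmul_eq_mul, ← mul_assoc,
            ENNReal.ofReal_mul (by norm_num)]
          norm_num
      _ ≤ _ := hle _ _ (by linarith)
  · refine (diam_sq_mul_sqNorm_area_le (K.card_eq t ht)
      fun y hy => (hpt ξ hξ t ht y hy).2).trans ?_
    rw [hv, ← mul_assoc, ← ENNReal.ofReal_mul hv0]
    exact hle _ _ (by linarith)
  · set S : Finset Plane → ℝ≥0∞ := fun t => sqNorm (area t) (ξ t)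
    have hcard : ∀ t e, e ∈ edges t → ((K.neighbours t e).card : ℝ≥0∞) ≤ ENNReal.ofReal N :=
      fun t e he => by
        rw [← ENNReal.ofReal_natCast]
        exact ENNReal.ofReal_le_ofReal (hK.card_neighbours_le hκ he)
    have hterm : ∀ t ∈ K.triangles, ∀ e ∈ edges t,
        ENNReal.ofReal (diam t) * sqNorm (arc e) (K.jump n ξ t e) ≤
          ENNReal.ofReal (N * B) * ∑ t' ∈ K.neighbours t e, (S t + S t') := by
      intro t ht e he
      refine diam_mul_sqNorm_arc_le (K.card_eq t ht) he fun y hy => ?_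
      have h1 : ∀ t' ∈ K.neighbours t e, ENNReal.ofReal (diam t) ^ 2 *
          (2 * (‖ξ t y‖ₑ ^ 2 + ‖ξ t' y‖ₑ ^ 2)) ≤ ENNReal.ofReal B * (S t + S t') := by
        intro t' ht'
        obtain ⟨ht'K, -, het'⟩ := Triangulation.mem_neighbours.1 ht'
        have hdd : diam t ≤ κ / 2 * diam t' := by
          classical
          obtain ⟨hsub, hc2⟩ := mem_edges.1 he
          obtain ⟨a, b, hab, rfl⟩ := Finset.card_eq_two.1 hc2
          refine (hK.diam_le hκ ht (hsub (by simp)) (hsub (by simp)) hab).trans ?_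
          gcongr
          exact dist_le_diam (mem_hull (het' (by simp))) (mem_hull (het' (by simp)))
        have ha := (hpt ξ hξ t ht y (hull_mono (mem_edges.1 he).1 hy)).1
        have hb := (hpt ξ hξ t' ht'K y (hull_mono het' hy)).1
        have hb' : ENNReal.ofReal (diam t) ^ 2 * ‖ξ t' y‖ₑ ^ 2 ≤
            ENNReal.ofReal ((κ / 2) ^ 2) * (ENNReal.ofReal C * S t') := by
          refine le_trans ?_ (mul_le_mul_right hb _)
          rw [← mul_assoc]
          gcongr
          rw [← ENNReal.ofReal_pow (diam_nonneg _), ← ENNReal.ofReal_pow (diam_nonneg _),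
            ← ENNReal.ofReal_mul (by positivity), ← mul_pow]
          exact ENNReal.ofReal_le_ofReal (pow_le_pow_left₀ (diam_nonneg t) hdd 2)
        calc _ = 2 * (ENNReal.ofReal (diam t) ^ 2 * ‖ξ t y‖ₑ ^ 2 +
              ENNReal.ofReal (diam t) ^ 2 * ‖ξ t' y‖ₑ ^ 2) := by ring
          _ ≤ 2 * (ENNReal.ofReal C * S t +
              ENNReal.ofReal ((κ / 2) ^ 2) * (ENNReal.ofReal C * S t')) := by gcongr
          _ = ENNReal.ofReal (2 * C) * S t + ENNReal.ofReal (2 * C * (κ / 2) ^ 2) * S t' := by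
              rw [ENNReal.ofReal_mul (p := 2 * C) (by positivity),
                ENNReal.ofReal_mul (p := 2) (by positivity)]
              norm_num
              ring
          _ ≤ ENNReal.ofReal B * S t + ENNReal.ofReal B * S t' := by
              have : 0 ≤ C * (κ / 2) ^ 2 := by positivity
              gcongr <;> simp only [B] <;> nlinarith
          _ = _ := by rw [mul_add]
      refine (mul_le_mul_right (Triangulation.enorm_jump_sq_le hn ξ ht he y) _).trans ?_
      rw [mul_left_comm, Finset.mul_sum (a := _ ^ 2), ENNReal.ofReal_mul hN, mul_assoc,
        Finset.mul_sum (a := ENNReal.ofReal B)]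
      exact mul_le_mul' (hcard t e he) (Finset.sum_le_sum h1)
    have hsum : ∑ t ∈ K.triangles, ∑ e ∈ edges t, ∑ _t' ∈ K.neighbours t e, S t ≤
        ENNReal.ofReal (3 * N) * ∑ t ∈ K.triangles, S t := by
      rw [Finset.mul_sum]
      refine Finset.sum_le_sum fun t ht => ?_
      calc _ ≤ ∑ e ∈ edges t, ENNReal.ofReal N * S t := by
            refine Finset.sum_le_sum fun e he => ?_
            rw [Finset.sum_const, nsmul_eq_mul]
            gcongr
            exact hcard t e he
        _ = _ := by
            rw [Finset.sum_const, card_edges (K.card_eq t ht), nsmul_eq_mul, ← mul_assoc,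
              ENNReal.ofReal_mul (by norm_num)]
            norm_num
    -- Exchanging the neighbours turns `S t + S t'` into `2 * S t`, and each `S t` is counted at
    -- most `3N` times; with `N * B` this gives `6 * (N * N * B)`.
    calc _ ≤ ∑ t ∈ K.triangles, ∑ e ∈ edges t,
          ENNReal.ofReal (N * B) * ∑ t' ∈ K.neighbours t e, (S t + S t') := by
          refine Finset.sum_le_sum fun t ht => ?_
          rw [Finset.mul_sum]
          exact Finset.sum_le_sum fun e he => hterm t ht e he
      _ = ENNReal.ofReal (N * B) *
          (2 * ∑ t ∈ K.triangles, ∑ e ∈ edges t, ∑ _t' ∈ K.neighbours t e, S t) := by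
          simp only [← Finset.mul_sum, Finset.sum_add_distrib]
          rw [Triangulation.sum_neighbours_comm, two_mul]
      _ ≤ ENNReal.ofReal (N * B) * (2 * (ENNReal.ofReal (3 * N) * ∑ t ∈ K.triangles, S t)) := by
          gcongr
      _ = ENNReal.ofReal (6 * (N * N * B)) * ∑ t ∈ K.triangles, S t := by
          rw [show 6 * (N * N * B) = N * B * (2 * (3 * N)) by ring,
            ENNReal.ofReal_mul (p := N * B) (by positivity), ENNReal.ofReal_mul (p := 2) (by norm_num)]
          norm_num
          ring
      _ ≤ _ := hle _ _ (by linarith)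

/-! ### Orthogonality of Hermite polynomials -/

lemma integrable_polynomial_mul_gaussian (q : Polynomial ℝ) :
    Integrable fun x : ℝ => q.eval x * Real.exp (-(x ^ 2 / 2)) := by
  simp_rw [Polynomial.eval_eq_sum_range, Finset.sum_mul]
  refine integrable_finsetSum _ fun k _ => ?_
  have h := integrable_rpow_mul_exp_neg_mul_sq (b := 1 / 2) (by norm_num) (s := (k : ℝ))
    (by linarith [(Nat.cast_nonneg k : (0 : ℝ) ≤ k)])
  refine (h.const_mul (q.coeff k)).congr (Filter.Eventually.of_forall fun x => ?_)
  simp only [Real.rpow_natCast]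
  rw [mul_assoc]
  congr 3
  ring

/-- The Hermite polynomials with real coefficients. -/
def realHermite (n : ℕ) : Polynomial ℝ := (Polynomial.hermite n).map (Int.castRingHom ℝ)

lemma aeval_hermite (n : ℕ) (x : ℝ) :
    Polynomial.aeval x (Polynomial.hermite n) = (realHermite n).eval x := by
  rw [realHermite, Polynomial.eval_map, Polynomial.aeval_def]; rfl

lemma realHermite_succ (n : ℕ) :
    realHermite (n + 1) = Polynomial.X * realHermite n - (realHermite n).derivative := by
  simp [realHermite, Polynomial.hermite_succ, Polynomial.derivative_map]

lemma natDegree_realHermite_le (n : ℕ) : (realHermite n).natDegree ≤ n :=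
  Polynomial.natDegree_map_le.trans_eq Polynomial.natDegree_hermite

/-- Since `(Heₙ e^{-x²/2})' = -Heₙ₊₁ e^{-x²/2}`, integration by parts lowers the Hermite index while
`q` loses a degree; in the base case `q = 0`. -/
lemma integral_mul_realHermite_eq_zero (n : ℕ) :
    ∀ q : Polynomial ℝ, q.degree < n →
      ∫ x : ℝ, q.eval x * ((realHermite n).eval x * Real.exp (-(x ^ 2 / 2))) = 0 := by
  induction n with
  | zero =>
    intro q hq
    have : q = 0 := Polynomial.degree_eq_bot.1 (Nat.WithBot.lt_zero_iff.1 (by simpa using hq))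
    simp [this]
  | succ n ih =>
    intro q hq
    have hder : ∀ x : ℝ, HasDerivAt (fun x => (realHermite n).eval x * Real.exp (-(x ^ 2 / 2)))
        (-((realHermite (n + 1)).eval x * Real.exp (-(x ^ 2 / 2)))) x := by
      intro x
      have h1 : HasDerivAt (fun x : ℝ => -(x ^ 2 / 2)) (-x) x := by
        refine ((hasDerivAt_pow 2 x).div_const 2).fun_neg.congr_deriv ?_
        norm_num
      refine (((realHermite n).hasDerivAt x).fun_mul h1.exp).congr_deriv ?_
      rw [realHermite_succ]
      simp only [Polynomial.eval_sub, Polynomial.eval_mul, Polynomial.eval_X]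
      ring
    have hint : ∀ p₁ p₂ : Polynomial ℝ,
        Integrable fun x : ℝ => p₁.eval x * (p₂.eval x * Real.exp (-(x ^ 2 / 2))) := by
      intro p₁ p₂
      simpa [mul_assoc] using integrable_polynomial_mul_gaussian (p₁ * p₂)
    have hparts := integral_mul_deriv_eq_deriv_mul_of_integrable
      (u := fun x => q.eval x) (u' := fun x => q.derivative.eval x)
      (v := fun x => (realHermite n).eval x * Real.exp (-(x ^ 2 / 2)))
      (v' := fun x => -((realHermite (n + 1)).eval x * Real.exp (-(x ^ 2 / 2))))
      (fun x _ => q.hasDerivAt x) (fun x _ => hder x)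
      (by simpa [Pi.mul_def] using (hint q (realHermite (n + 1))).neg)
      (hint _ _) (hint _ _)
    rw [ih q.derivative] at hparts
    · simpa [integral_neg] using hparts
    · rw [Polynomial.degree_lt_iff_coeff_zero] at hq ⊢
      intro m hm
      rw [Polynomial.coeff_derivative, hq (m + 1) (by omega), zero_mul]

/-- After rescaling to the standard Gaussian, the product of the first two factors has degree at
most `i + j < k` and is orthogonal to the third. -/
lemma integral_scaledHermite_eq_zero {s : ℝ} (hs : 0 < s) {i j k : ℕ} (h : i + j < k) :
    ∫ z, scaledHermite s i z * scaledHermite s j z * scaledHermite s k z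
      ∂(gaussianReal 0 (Real.toNNReal (s ^ 2))) = 0 := by
  set c : ℝ := (Real.sqrt (i.factorial : ℝ))⁻¹ * (Real.sqrt (j.factorial : ℝ))⁻¹ *
    (Real.sqrt (k.factorial : ℝ))⁻¹
  set F : ℝ → ℝ := fun x => c * ((realHermite i * realHermite j).eval x * (realHermite k).eval x)
    with hF
  have hFc : Continuous F := by
    have := (realHermite i * realHermite j).continuous
    have := (realHermite k).continuous
    fun_prop
  have h1 : ∀ z, scaledHermite s i z * scaledHermite s j z * scaledHermite s k z = F (z / s) := by
    intro z
    simp only [scaledHermite, aeval_hermite, hF, c, Polynomial.eval_mul]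
    ring
  have h2 : (gaussianReal 0 (Real.toNNReal (s ^ 2))).map (· / s) = gaussianReal 0 1 := by
    rw [gaussianReal_map_div_const, zero_div]
    congr 1
    ext
    simp [hs.ne', Real.coe_toNNReal _ (sq_nonneg s)]
  simp_rw [h1]
  rw [← integral_map (φ := (· / s)) (by fun_prop) hFc.aestronglyMeasurable, h2,
    integral_gaussianReal_eq_integral_smul one_ne_zero]
  have hdeg : (realHermite i * realHermite j).degree < k := by
    refine Polynomial.degree_le_natDegree.trans_lt ?_
    refine WithBot.coe_lt_coe.2 (lt_of_le_of_lt ?_ h)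
    exact Polynomial.natDegree_mul_le.trans
      (add_le_add (natDegree_realHermite_le i) (natDegree_realHermite_le j))
  calc _ = ∫ x : ℝ, ((Real.sqrt (2 * Real.pi))⁻¹ * c) * ((realHermite i * realHermite j).eval x *
        ((realHermite k).eval x * Real.exp (-(x ^ 2 / 2)))) := by
        refine integral_congr_ae (Filter.Eventually.of_forall fun x => ?_)
        simp only [gaussianPDFReal, hF, smul_eq_mul, NNReal.coe_one, mul_one, sub_zero, neg_div]
        ring
    _ = 0 := by
        rw [integral_const_mul, integral_mul_realHermite_eq_zero k _ hdeg, mul_zero]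

/-- Some coordinate has `μ_m ≥ d_m + d̂_m - 1`, whereas `α_m + β_m ≤ d_m + d̂_m - 2`; that
one-dimensional factor vanishes. -/
lemma tripleProd_eq_zero {M : ℕ} {s : Fin M → ℝ} (hs : ∀ m, 0 < s m) {d dhat α β μ : Fin M → ℕ}
    (hα : α ∈ indexBox d) (hβ : β ∈ indexBox dhat)
    (hμ : μ ∉ indexBox (fun m => d m + dhat m - 1)) : tripleProd s α β μ = 0 := by
  simp only [indexBox, Fintype.mem_piFinset, Finset.mem_range, not_forall] at hα hβ hμ
  obtain ⟨m, hm⟩ := hμ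
  refine Finset.prod_eq_zero (Finset.mem_univ m) (integral_scaledHermite_eq_zero (hs m) ?_)
  have := hα m
  have := hβ m
  omega

/-! ### Residual coefficients as elementwise polynomial fields -/

section IsPolyOn

variable {k l : ℕ} {S : Set Plane} {g g' : Plane → ℝ}

lemma IsPolyOn.mono (h : IsPolyOn k S g) (hkl : k ≤ l) : IsPolyOn l S g := by
  obtain ⟨q, hq, hg⟩ := h
  exact ⟨q, hq.trans hkl, hg⟩

lemma IsPolyOn.const_mul (h : IsPolyOn k S g) (c : ℝ) : IsPolyOn k S (fun x => c * g x) := by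
  obtain ⟨q, hq, hg⟩ := h
  exact ⟨c • q, (MvPolynomial.totalDegree_smul_le _ _).trans hq, fun x hx => by simp [hg x hx]⟩

lemma IsPolyOn.mul (h : IsPolyOn k S g) (h' : IsPolyOn l S g') :
    IsPolyOn (k + l) S (fun x => g x * g' x) := by
  obtain ⟨q, hq, hg⟩ := h
  obtain ⟨q', hq', hg'⟩ := h'
  exact ⟨q * q', (MvPolynomial.totalDegree_mul _ _).trans (add_le_add hq hq'),
    fun x hx => by simp [hg x hx, hg' x hx]⟩

lemma IsPolyOn.sum {ι : Type*} {s : Finset ι} {g : ι → Plane → ℝ}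
    (h : ∀ i ∈ s, IsPolyOn k S (g i)) : IsPolyOn k S (fun x => ∑ i ∈ s, g i x) := by
  choose! q hq hg using h
  exact ⟨∑ i ∈ s, q i, MvPolynomial.totalDegree_finsetSum_le hq,
    fun x hx => by rw [map_sum]; exact Finset.sum_congr rfl fun i hi => hg i hi x hx⟩

lemma gradientWithin_apply (f : Plane → ℝ) (S : Set Plane) (x : Plane) (i : Fin 2) :
    gradientWithin f S x i = fderivWithin ℝ f S x (EuclideanSpace.single i 1) := by
  rw [gradientWithin, ← InnerProductSpace.toDual_symm_apply, EuclideanSpace.inner_single_right]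
  simp

lemma IsPolyOn.gradientWithin (hS : UniqueDiffOn ℝ S) (h : IsPolyOn k S g) (i : Fin 2) :
    IsPolyOn (k - 1) S (fun x => gradientWithin g S x i) := by
  obtain ⟨q, hq, hg⟩ := h
  refine ⟨MvPolynomial.pderiv i q, (totalDegree_pderiv_le q i).trans (Nat.sub_le_sub_right hq 1),
    fun x hx => ?_⟩
  have hg' : Set.EqOn g (polyFun q) S := hg
  change _root_.gradientWithin g S x i = _
  rw [gradientWithin_apply, fderivWithin_congr hg' (hg' hx),
    (differentiable_polyFun q x).fderivWithin (hS x hx), fderiv_polyFun_single]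
  rfl

end IsPolyOn

lemma differentiableWithinAt_of_isPolyOn {k : ℕ} {S : Set Plane} {ξ : Plane → Plane}
    (h : ∀ i, IsPolyOn k S (fun x => ξ x i)) {x : Plane} (hx : x ∈ S) :
    DifferentiableWithinAt ℝ ξ S x := by
  choose q _ hq using h
  exact differentiableWithinAt_of_eqOn_polyFun (q := q) hq hx

lemma divWithin_sum_smul {ι : Type*} {S : Set Plane} (hS : UniqueDiffOn ℝ S) (F : Finset ι)
    (c : ι → ℝ) {ξ : ι → Plane → Plane} {x : Plane} (hx : x ∈ S)
    (hξ : ∀ μ ∈ F, DifferentiableWithinAt ℝ (ξ μ) S x) :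
    divWithin S (fun x => ∑ μ ∈ F, c μ • ξ μ x) x = ∑ μ ∈ F, c μ * divWithin S (ξ μ) x := by
  have h : fderivWithin ℝ (fun x => ∑ μ ∈ F, c μ • ξ μ x) S x =
      ∑ μ ∈ F, c μ • fderivWithin ℝ (ξ μ) S x := by
    rw [fderivWithin_fun_sum (hS x hx) fun μ hμ => (hξ μ hμ).fun_const_smul (c μ)]
    exact Finset.sum_congr rfl fun μ hμ => fderivWithin_fun_const_smul (hS x hx) (hξ μ hμ) _
  simp only [divWithin, h, Finset.mul_sum]
  rw [Finset.sum_comm]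
  simp

lemma divWithin_zero (S : Set Plane) (x : Plane) : divWithin S (fun _ => 0) x = 0 := by
  simp [divWithin]

section Jump

variable {D : Set Plane} (K : Triangulation D) (n : Finset Plane → Plane)

lemma Triangulation.jump_sum_smul {ι : Type*} (F : Finset ι) (c : ι → ℝ)
    (ξ : ι → Finset Plane → Plane → Plane) (t e : Finset Plane) (x : Plane) :
    K.jump n (fun t x => ∑ μ ∈ F, c μ • ξ μ t x) t e x = ∑ μ ∈ F, c μ * K.jump n (ξ μ) t e x := by
  simp only [Triangulation.jump, Finset.mul_sum]
  rw [Finset.sum_comm]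
  refine Finset.sum_congr rfl fun t' _ => ?_
  rw [← Finset.sum_sub_distrib, sum_inner]
  exact Finset.sum_congr rfl fun μ _ => by rw [← smul_sub, real_inner_smul_left]

lemma Triangulation.jump_zero (t e : Finset Plane) (x : Plane) :
    K.jump n (fun _ _ => 0) t e x = 0 := by
  simp [Triangulation.jump]

end Jump

section Residual

variable {D : Set Plane} {K : Triangulation D} {p M : ℕ} {d dhat : Fin M → ℕ}
  (s : Fin M → ℝ) (a : DiscreteFun K p dhat) (w : DiscreteFun K p d)

lemma isPolyOn_resCoeff (hp : 1 ≤ p) {t : Finset Plane} (ht : t ∈ K.triangles) (μ : Fin M → ℕ)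
    (i : Fin 2) : IsPolyOn (2 * p - 1) (hull t) (fun x => resCoeff s a w (hull t) μ x i) := by
  have hS := K.uniqueDiffOn_hull ht
  have h : IsPolyOn (p + (p - 1)) (hull t) (fun x => ∑ α ∈ indexBox d, ∑ β ∈ indexBox dhat,
      tripleProd s α β μ * (a.coeff β x * gradientWithin (w.coeff α) (hull t) x i)) :=
    IsPolyOn.sum fun α hα => IsPolyOn.sum fun β hβ =>
      (((a.coeff_mem β hβ).2 t ht).mul (((w.coeff_mem α hα).2 t ht).gradientWithin hS i)).const_mul _
  have heq : (fun x => resCoeff s a w (hull t) μ x i) = fun x => ∑ α ∈ indexBox d,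
      ∑ β ∈ indexBox dhat,
        tripleProd s α β μ * (a.coeff β x * gradientWithin (w.coeff α) (hull t) x i) := by
    ext x
    simp [resCoeff, mul_assoc]
  rw [heq]
  exact h.mono (by omega)

lemma resCoeff_eq_zero (hs : ∀ m, 0 < s m) (S : Set Plane) {μ : Fin M → ℕ}
    (hμ : μ ∉ indexBox (fun m => d m + dhat m - 1)) : resCoeff s a w S μ = fun _ => 0 := by
  ext1 x
  refine Finset.sum_eq_zero fun α hα => Finset.sum_eq_zero fun β hβ => ?_
  rw [tripleProd_eq_zero hs hα hβ hμ, zero_mul, zero_smul]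

/-- At interior points both sets are neighbourhoods, so both gradients within them are the ordinary
gradient. -/
lemma resCoeff_hull_eq {t : Finset Plane} (ht : t ∈ K.triangles) (μ : Fin M → ℕ) {x : Plane}
    (hx : x ∈ interior (hull t)) : resCoeff s a w (hull t) μ x = resCoeff s a w D μ x := by
  have h1 : hull t ∈ nhds x := mem_interior_iff_mem_nhds.1 hx
  have h2 : D ∈ nhds x := K.isOpen.mem_nhds (K.interior_hull_subset ht hx)
  simp only [resCoeff, gradientWithin, fderivWithin_of_mem_nhds h1, fderivWithin_of_mem_nhds h2]

/-- A finite combination of residual coefficients, as an elementwise field. -/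
def resField (F : Finset (Fin M → ℕ)) (c : (Fin M → ℕ) → ℝ) (t : Finset Plane) (x : Plane) : Plane :=
  ∑ μ ∈ F, c μ • resCoeff s a w (hull t) μ x

lemma isPolyField_resField (hp : 1 ≤ p) (F : Finset (Fin M → ℕ)) (c : (Fin M → ℕ) → ℝ) :
    K.IsPolyField (2 * p - 1) (resField s a w F c) := by
  intro t ht i
  have h := IsPolyOn.sum (s := F) fun μ _ => (isPolyOn_resCoeff s a w hp ht μ i).const_mul (c μ)
  simpa [resField] using h

/-- Triangles may be replaced by their interiors because convex sets have null frontier. These are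
almost disjoint and lie in `D`, which is all that the inequality requires. -/
lemma sum_sqNorm_resField_le (F : Finset (Fin M → ℕ)) (c : (Fin M → ℕ) → ℝ) :
    ∑ t ∈ K.triangles, sqNorm (area t) (resField s a w F c t) ≤
      sqNorm (volume.restrict D) (fun x => ∑ μ ∈ F, c μ • resCoeff s a w D μ x) := by
  set G : Plane → Plane := fun x => ∑ μ ∈ F, c μ • resCoeff s a w D μ x with hG
  have h1 : ∀ t ∈ K.triangles, sqNorm (area t) (resField s a w F c t) =
      ∫⁻ x in interior (hull t), ‖G x‖ₑ ^ 2 := by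
    intro t ht
    rw [sqNorm, area, ← setLIntegral_congr (interior_hull_ae_eq t)]
    refine setLIntegral_congr_fun isOpen_interior.measurableSet fun x hx => ?_
    simp only [resField, hG]
    congr 3
    ext1 μ
    rw [resCoeff_hull_eq s a w ht μ hx]
  rw [Finset.sum_congr rfl h1, ← lintegral_biUnion_finset₀
    (fun t ht t' ht' htt' => (K.aedisjoint_hull ht ht' htt').mono interior_subset interior_subset)
    fun t _ => isOpen_interior.measurableSet.nullMeasurableSet]
  exact lintegral_mono_set (Set.iUnion₂_subset fun t ht => K.interior_hull_subset ht)

end Residual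

/-! ### Comparison of the estimator contributions -/

/-- The index set may be infinite, but only finitely many residual terms are nonzero. -/
lemma tsum_subtype_eq_sum_of_subset {ι A : Type*} [AddCommMonoid A] [TopologicalSpace A]
    {S : Set ι} {F : Finset ι} (g : ι → A) (hF : ↑F ⊆ S) (hg : ∀ μ ∈ S, μ ∉ F → g μ = 0) :
    ∑' μ : S, g μ = ∑ μ ∈ F, g μ := by
  rw [tsum_subtype S g, tsum_eq_sum (s := F) fun μ hμ => ?_]
  · exact Finset.sum_congr rfl fun μ hμ => Set.indicator_of_mem (hF hμ) g
  · by_cases h : μ ∈ S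
    · rw [Set.indicator_of_mem h, hg μ h hμ]
    · exact Set.indicator_of_notMem h g

lemma sum_lintegral_le {ι α : Type*} [MeasurableSpace α] (ν : Measure α) (F : Finset ι)
    (g : ι → α → ℝ≥0∞) : ∑ i ∈ F, ∫⁻ y, g i y ∂ν ≤ ∫⁻ y, ∑ i ∈ F, g i y ∂ν := by
  classical
  induction F using Finset.induction_on with
  | empty => simp
  | insert i F hi ih =>
    simp only [Finset.sum_insert hi]
    exact (add_le_add_right ih _).trans (le_lintegral_add _ _)

section Comparison

variable {D : Set Plane} {K : Triangulation D} {p M : ℕ} {d dhat : Fin M → ℕ} {s : Fin M → ℝ}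

open Classical in
/-- The indices of the boundary of `Λ_d` that belong to `Λ`. -/
def boundaryFinset (d dhat : Fin M → ℕ) (Λ : Set (Fin M → ℕ)) : Finset (Fin M → ℕ) :=
  (indexBox (fun m => d m + dhat m - 1)).filter (fun μ => μ ∈ Λ ∧ μ ∉ indexBox d)

lemma coe_boundaryFinset (Λ : Set (Fin M → ℕ)) :
    (boundaryFinset d dhat Λ : Set (Fin M → ℕ)) = Λ ∩ indexBoundary d dhat := by
  ext μ
  simp only [boundaryFinset, Finset.coe_filter, indexBoundary]
  constructor
  · rintro ⟨h1, h2, h3⟩; exact ⟨h2, h1, h3⟩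
  · rintro ⟨h2, h1, h3⟩; exact ⟨h1, h2, h3⟩

open Classical in
lemma notMem_indexBox_of_notMem_boundaryFinset {Λ : Set (Fin M → ℕ)} {μ : Fin M → ℕ}
    (hμ : μ ∈ Λ \ (indexBox d : Set (Fin M → ℕ))) (h : μ ∉ boundaryFinset d dhat Λ) :
    μ ∉ indexBox (fun m => d m + dhat m - 1) := fun hb =>
  h (Finset.mem_filter.2 ⟨hb, hμ.1, hμ.2⟩)

open Classical in
lemma boundaryFinset_subset (Λ : Set (Fin M → ℕ)) :
    (boundaryFinset d dhat Λ : Set (Fin M → ℕ)) ⊆ Λ \ (indexBox d : Set (Fin M → ℕ)) :=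
  fun _ h => (Finset.mem_filter.1 h).2

variable (a : DiscreteFun K p dhat) (w : DiscreteFun K p d)

/-- As all `d_m ≥ 1`, the zero index lies in `Λ_d` and `f` drops out; linearity of the divergence
does the rest, and the sign is lost in the norm. -/
lemma sqNorm_volume_residual (hp : 1 ≤ p) (hs : ∀ m, 0 < s m) (hd : ∀ m, 1 ≤ d m)
    (f : Plane → ℝ) (Λ : Set (Fin M → ℕ)) {t : Finset Plane} (ht : t ∈ K.triangles)
    (y : Fin M → ℝ) :
    sqNorm (area t) (fun x => ∑' μ : ↥(Λ \ (indexBox d : Set (Fin M → ℕ))),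
      ((if (μ : Fin M → ℕ) = 0 then f x else 0)
        - divWithin (hull t) (resCoeff s a w (hull t) μ) x) * basisPoly s μ y * zeta s y) =
      sqNorm (area t) (divWithin (hull t) (resField s a w (boundaryFinset d dhat Λ)
        (fun μ => basisPoly s μ y * zeta s y) t)) := by
  refine setLIntegral_congr_fun (measurableSet_hull t) fun x hx => ?_
  have h0 : ∀ μ ∈ Λ \ (indexBox d : Set (Fin M → ℕ)), μ ≠ 0 := by
    rintro μ hμ rfl
    exact hμ.2 (by simp [indexBox, Nat.pos_iff_ne_zero, fun m => (Nat.one_le_iff_ne_zero.1 (hd m))])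
  have h1 : ∑' μ : ↥(Λ \ (indexBox d : Set (Fin M → ℕ))),
      ((if (μ : Fin M → ℕ) = 0 then f x else 0)
        - divWithin (hull t) (resCoeff s a w (hull t) μ) x) * basisPoly s μ y * zeta s y =
      -divWithin (hull t) (resField s a w (boundaryFinset d dhat Λ)
        (fun μ => basisPoly s μ y * zeta s y) t) x := by
    have hdiv := divWithin_sum_smul (K.uniqueDiffOn_hull ht) (boundaryFinset d dhat Λ)
      (fun μ => basisPoly s μ y * zeta s y) hx fun μ _ =>
        differentiableWithinAt_of_isPolyOn (isPolyOn_resCoeff s a w hp ht μ) hx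
    rw [tsum_subtype_eq_sum_of_subset (fun μ => ((if μ = 0 then f x else 0)
        - divWithin (hull t) (resCoeff s a w (hull t) μ) x) * basisPoly s μ y * zeta s y)
      (boundaryFinset_subset Λ) fun μ hμ hμF => ?_]
    · change _ = -divWithin (hull t) (fun x => ∑ μ ∈ boundaryFinset d dhat Λ,
        (basisPoly s μ y * zeta s y) • resCoeff s a w (hull t) μ x) x
      rw [hdiv, ← Finset.sum_neg_distrib]
      refine Finset.sum_congr rfl fun μ hμ => ?_
      rw [if_neg (h0 μ (boundaryFinset_subset Λ hμ))]
      ring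
    · rw [if_neg (h0 μ hμ), resCoeff_eq_zero s a w hs _
        (notMem_indexBox_of_notMem_boundaryFinset hμ hμF), divWithin_zero]
      ring
  simp only [h1, enorm_neg]

lemma tsum_jump_residual (hs : ∀ m, 0 < s m) (n : Finset Plane → Plane) (Λ : Set (Fin M → ℕ))
    (t e : Finset Plane) (y : Fin M → ℝ) (x : Plane) :
    ∑' μ : ↥(Λ \ (indexBox d : Set (Fin M → ℕ))),
      K.jump n (fun t' => resCoeff s a w (hull t') μ) t e x * basisPoly s μ y * zeta s y =
      K.jump n (resField s a w (boundaryFinset d dhat Λ)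
        (fun μ => basisPoly s μ y * zeta s y)) t e x := by
  rw [tsum_subtype_eq_sum_of_subset (fun μ => K.jump n (fun t' => resCoeff s a w (hull t') μ) t e x
      * basisPoly s μ y * zeta s y) (boundaryFinset_subset Λ) fun μ hμ hμF => ?_]
  · refine Eq.trans ?_ (K.jump_sum_smul n (boundaryFinset d dhat Λ)
      (fun μ => basisPoly s μ y * zeta s y) (fun μ t' => resCoeff s a w (hull t') μ) t e x).symm
    exact Finset.sum_congr rfl fun μ _ => by ring
  · simp only [resCoeff_eq_zero s a w hs _ (notMem_indexBox_of_notMem_boundaryFinset hμ hμF)]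
    rw [K.jump_zero, zero_mul, zero_mul]

lemma etaDet_le {n : Finset Plane → Plane} {c : ℝ} (hc : 0 < c)
    (hK : K.InverseEstimates n (2 * p - 1) c) (hp : 1 ≤ p) (hs : ∀ m, 0 < s m)
    (hd : ∀ m, 1 ≤ d m) (f : Plane → ℝ) (Λ : Set (Fin M → ℕ)) :
    etaDet n s a f w (Λ \ (indexBox d : Set (Fin M → ℕ))) ≤
      ENNReal.ofReal (Real.sqrt 2 * c) * etaSto s a w (Λ ∩ indexBoundary d dhat) := by
  set F := boundaryFinset d dhat Λ
  let ξ : (Fin M → ℝ) → Finset Plane → Plane → Plane :=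
    fun y => resField s a w F (fun μ => basisPoly s μ y * zeta s y)
  let V : Finset Plane → (Fin M → ℝ) → ℝ≥0∞ := fun t y =>
    sqNorm (area t) (divWithin (hull t) (ξ y t))
  let J : Finset Plane → Finset Plane → (Fin M → ℝ) → ℝ≥0∞ := fun t e y =>
    sqNorm (arc e) (K.jump n (ξ y) t e)
  let R : (Fin M → ℝ) → ℝ≥0∞ := fun y => sqNorm (volume.restrict D) (fun x =>
    ∑' μ : ↥(Λ ∩ indexBoundary d dhat), (basisPoly s μ y * zeta s y) • resCoeff s a w D μ x)
  have hR : ∀ y, ∑ t ∈ K.triangles, sqNorm (area t) (ξ y t) ≤ R y := fun y => by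
    refine (sum_sqNorm_resField_le s a w F _).trans_eq ?_
    simp only [R]
    congr 1
    ext1 x
    rw [tsum_subtype_eq_sum_of_subset (fun μ => (basisPoly s μ y * zeta s y) •
      resCoeff s a w D μ x) (coe_boundaryFinset Λ).subset fun μ hμ hμF => ?_]
    exact absurd (Finset.mem_coe.1 ((coe_boundaryFinset Λ).symm ▸ hμ)) hμF
  -- With `y` frozen, `P_μ(y) ζ(y)` are real scalars and the inverse estimates apply to the combined
  -- field; the 2 counts the volume and the jump term.
  have hpoint : ∀ y, ∑ t ∈ K.triangles, (ENNReal.ofReal (diam t) ^ 2 * V t y +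
      ENNReal.ofReal (diam t) * ∑ e ∈ edges t, J t e y) ≤ 2 * ENNReal.ofReal c ^ 2 * R y := by
    intro y
    have hpoly := isPolyField_resField s a w hp F (fun μ => basisPoly s μ y * zeta s y)
    calc _ ≤ ENNReal.ofReal c ^ 2 * ∑ t ∈ K.triangles, sqNorm (area t) (ξ y t) +
          ENNReal.ofReal c ^ 2 * ∑ t ∈ K.triangles, sqNorm (area t) (ξ y t) := by
          rw [Finset.sum_add_distrib]
          refine add_le_add ?_ (hK.jump _ hpoly)
          rw [Finset.mul_sum]
          exact Finset.sum_le_sum fun t ht => hK.div _ hpoly t ht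
      _ = 2 * ENNReal.ofReal c ^ 2 * ∑ t ∈ K.triangles, sqNorm (area t) (ξ y t) := by ring
      _ ≤ _ := mul_le_mul_right (hR y) _
  have hsum : ∑ t ∈ K.triangles, (etaVolSq s a f w t (Λ \ (indexBox d : Set (Fin M → ℕ))) +
      etaJumpSq n s a w t (Λ \ (indexBox d : Set (Fin M → ℕ)))) ≤
      2 * ENNReal.ofReal c ^ 2 * ∫⁻ y, R y ∂(piZero M) := by
    have hterm : ∀ t ∈ K.triangles, etaVolSq s a f w t (Λ \ (indexBox d : Set (Fin M → ℕ))) +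
        etaJumpSq n s a w t (Λ \ (indexBox d : Set (Fin M → ℕ))) ≤
        ∫⁻ y, (ENNReal.ofReal (diam t) ^ 2 * V t y +
          ENNReal.ofReal (diam t) * ∑ e ∈ edges t, J t e y) ∂(piZero M) := by
      intro t ht
      -- Sums and constants are moved inside the integral only in the direction that holds for
      -- arbitrary functions.
      refine le_trans (add_le_add ?_ ?_) (le_lintegral_add _ _)
      · rw [etaVolSq, mixedSqNorm]
        simp only [sqNorm_volume_residual (dhat := dhat) a w hp hs hd f Λ ht]
        exact lintegral_const_mul_le _ _
      · rw [etaJumpSq]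
        simp only [mixedSqNorm, tsum_jump_residual a w hs]
        exact (mul_le_mul_right (sum_lintegral_le _ _ _) _).trans (lintegral_const_mul_le _ _)
    refine ((Finset.sum_le_sum hterm).trans (sum_lintegral_le _ _ _)).trans ?_
    rw [← lintegral_const_mul' _ _ (by finiteness)]
    exact lintegral_mono hpoint
  have hconst : ENNReal.ofReal (Real.sqrt 2 * c) = (2 * ENNReal.ofReal c ^ 2) ^ (1 / 2 : ℝ) := by
    have : 2 * ENNReal.ofReal c ^ 2 = ENNReal.ofReal (Real.sqrt 2 * c) ^ (2 : ℝ) := by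
      rw [ENNReal.rpow_ofNat, ← ENNReal.ofReal_pow (p := Real.sqrt 2 * c) (by positivity), mul_pow,
        Real.sq_sqrt (by norm_num), ENNReal.ofReal_mul (by norm_num), ENNReal.ofReal_pow hc.le]
      norm_num
    rw [this, ← ENNReal.rpow_mul]
    norm_num
  rw [etaDet, etaSto, hconst, ← ENNReal.mul_rpow_of_nonneg _ _ (by norm_num)]
  exact ENNReal.rpow_le_rpow hsum (by norm_num)

end Comparison

end SGFEM

end

theorem theorem4p8 (p : ℕ) (hp : 1 ≤ p) :
    (∀ κ : ℝ, 0 < κ → ∃ cinv : ℝ, 0 < cinv ∧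
      ∀ (D : Set SGFEM.Plane) (K : SGFEM.Triangulation D), K.ShapeRegular κ →
        ∀ n : Finset SGFEM.Plane → SGFEM.Plane, K.IsUnitNormal n →
          K.InverseEstimates n (2 * p - 1) cinv) ∧
    (∀ (D : Set SGFEM.Plane) (K : SGFEM.Triangulation D)
      (n : Finset SGFEM.Plane → SGFEM.Plane), K.IsUnitNormal n →
      ∀ cinv : ℝ, 0 < cinv → K.InverseEstimates n (2 * p - 1) cinv →
      ∀ (M : ℕ) (γ : Fin M → SGFEM.Plane → ℝ),
      (∀ m, MeasureTheory.MemLp (γ m) ⊤ (MeasureTheory.volume.restrict D)) →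
      ∀ ρ : ℝ, 0 ≤ ρ → ∀ ϑ : ℝ, 0 ≤ ϑ → ϑ ≤ 1 →
      ∀ f : SGFEM.Plane → ℝ, MeasureTheory.MemLp f 2 (MeasureTheory.volume.restrict D) →
      ∀ d dhat : Fin M → ℕ, (∀ m, 1 ≤ d m) → (∀ m, 1 ≤ dhat m) →
      ∀ (aN : SGFEM.DiscreteFun K p dhat) (vN : SGFEM.DiscreteFun K p d)
        (Λhat : Set (Fin M → ℕ)), (SGFEM.indexBox d : Set (Fin M → ℕ)) ⊆ Λhat →
        SGFEM.etaDet n (SGFEM.sigma D γ (ϑ * ρ)) aN f vN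
            (Λhat \ (SGFEM.indexBox d : Set (Fin M → ℕ)))
          ≤ ENNReal.ofReal (Real.sqrt 2 * cinv) *
            SGFEM.etaSto (SGFEM.sigma D γ (ϑ * ρ)) aN vN
              (Λhat ∩ SGFEM.indexBoundary d dhat)) := by
  refine ⟨fun κ hκ => SGFEM.exists_inverseEstimates (2 * p - 1) hκ, ?_⟩
  intro D K n _ c hc hK M γ _ ρ _ ϑ _ _ f _ d dhat hd _ aN vN Λhat _
  exact SGFEM.etaDet_le aN vN hc hK hp (fun m => Real.exp_pos _) hd f Λhat
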